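/- Let $H$ be a real separable Hilbert space and let $A$ be a densely defined, nonnegative, self-adjoint (in general unbounded) operator on $H$ with compact inverse. Define $A^{s}$ by the spectral decomposition of $A$ and put $\|v\|_s=\|A^{s/2}v\|$. Let $0\neq b\in L^1_{\mathrm{loc}}([0,\infty))$ be a real kernel that is $3$-monotone (on $(0,\infty)$, $b$ is differentiable and both $b$ and $-\dot b$ are nonnegative, nonincreasing and convex), with $\lim_{t\to\infty}b(t)=0$, and suppose that, with the Laplace transform $\widehat b(z)=\int_0^\infty b(t)e^{-zt}\,dt$ for $\operatorname{Re}z>0$, $$\rho:=1+\frac{2}{\pi}\sup\{|\arg\widehat b(z)|:\operatorname{Re}z>0\}\in(1,2).$$ For $\Delta t>0$ let the weights $\omega_k$ be given by $\sum_{k\ge0}\omega_kz^k=\widehat b\big((1-z)/\Delta t\big)$, $|z|<1$. There is a constant $C>0$, depending only on $A$ and $b$, such that the following holds for every $\Delta t>0$. There are bounded linear operators $B_k$, $k\ge 0$, on $H$ such that for every $x\in H$ the sequence $v_k=B_kx$ is the unique solution of $$v_n-v_{n-1}+\Delta t\sum_{k=1}^{n}\omega_{n-k}Av_k=0,\quad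 n\ge1,\qquad v_0=x,$$ with $v_n\in D(A)$ for $n\ge1$, and these operators satisfy, for all $x\in H$, $$\sup_{k\ge1}\|B_kx\|\le\|x\|\qquad\text{and}\qquad \Delta t\sum_{k=1}^{n}\|B_kx\|^2\le C\|x\|^2_{-1/\rho}\quad\text{for all } n\ge1.$$ -/

import Mathlib

open MeasureTheory Filter Topology Set

noncomputable section

namespace VolterraEuler

/-- Laplace transform `∫₀^∞ f(t) exp(-z t) dt` of a real kernel, used for `0 < re z`. -/
def laplace (f : ℝ → ℝ) (z : ℂ) : ℂ :=
  ∫ t in Ioi (0 : ℝ), (f t : ℂ) * Complex.exp (-z * (t : ℂ))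

/-- A `3`-monotone kernel on `(0, ∞)`: both `b` and `-b'` are nonnegative, nonincreasing and
convex there.  (Convexity makes `b'` continuous, so `b` is `C¹` on `(0, ∞)`.)
Values of `b` at `t ≤ 0` are irrelevant. -/
structure IsThreeMonotone (b : ℝ → ℝ) : Prop where
  differentiableOn : DifferentiableOn ℝ b (Ioi 0)
  nonneg : ∀ t, 0 < t → 0 ≤ b t
  antitoneOn : AntitoneOn b (Ioi 0)
  convexOn : ConvexOn ℝ (Ioi 0) b
  neg_deriv_nonneg : ∀ t, 0 < t → 0 ≤ -deriv b t
  neg_deriv_antitoneOn : AntitoneOn (fun t => -deriv b t) (Ioi 0)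
  neg_deriv_convexOn : ConvexOn ℝ (Ioi 0) (fun t => -deriv b t)

/-- The number `ρ = 1 + (2/π) sup {|arg b̂(z)| : re z > 0}`.  The set is nonempty and bounded by
`π`, so the supremum is a genuine one. -/
def rho (b : ℝ → ℝ) : ℝ :=
  1 + 2 / Real.pi * sSup {θ : ℝ | ∃ z : ℂ, 0 < z.re ∧ θ = |Complex.arg (laplace b z)|}

/-- The standing assumption on the memory kernel: `0 ≠ b ∈ L¹_loc([0, ∞))` is `3`-monotone,
tends to `0` at infinity, and `ρ ∈ (1, 2)`. -/
structure KernelAssumption (b : ℝ → ℝ) : Prop where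
  locallyIntegrableOn : LocallyIntegrableOn b (Ici 0) volume
  ne_zero : ∃ t, 0 < t ∧ b t ≠ 0
  threeMonotone : IsThreeMonotone b
  tendsto_zero : Tendsto b atTop (𝓝 0)
  one_lt_rho : 1 < rho b
  rho_lt_two : rho b < 2

/-- Weights of the convolution quadrature: `ω_k` is the `k`-th Taylor coefficient at `0` of
`z ↦ b̂((1 - z)/Δt)`, i.e. `∑ ω_k z^k = b̂((1 - z)/Δt)` for `|z| < 1`.  These coefficients are
real numbers because `b` is real valued; `re` only changes the type. -/
def weight (b : ℝ → ℝ) (dt : ℝ) (k : ℕ) : ℝ :=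
  (iteratedDeriv k (fun z : ℂ => laplace b ((1 - z) / (dt : ℂ))) 0 / (k.factorial : ℂ)).re

variable {H : Type*} [NormedAddCommGroup H] [InnerProductSpace ℝ H] [CompleteSpace H]

/-- A densely defined, nonnegative, self-adjoint (in general unbounded) operator on `H` with
compact inverse.  Density of the domain is part of `IsSelfAdjoint`
(`IsSelfAdjoint.dense_domain`). -/
structure OperatorAssumption (A : H →ₗ.[ℝ] H) : Prop where
  isSelfAdjoint : IsSelfAdjoint A
  nonneg : ∀ u : A.domain, 0 ≤ inner ℝ (A u) (u : H)
  compact_inverse : ∃ K : H →L[ℝ] H, IsCompactOperator K ∧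
    (∀ y : H, ∃ h : K y ∈ A.domain, A ⟨K y, h⟩ = y) ∧ ∀ u : A.domain, K (A u) = (u : H)

/-- The eigenspace `{u ∈ D(A) : A u = μ u}`, as a subspace of `H`. -/
def eigenspace (A : H →ₗ.[ℝ] H) (μ : ℝ) : Submodule ℝ H :=
  (LinearMap.ker (A.toFun - μ • A.domain.subtype)).map A.domain.subtype

/-- Fractional powers through the spectral decomposition: `A^s x = ∑_μ μ^s P_μ x`, where `μ` runs
over the eigenvalues and `P_μ` is the orthogonal projection onto the eigenspace of `μ` (which is
closed when `A` is; for `μ` not an eigenvalue, `P_μ = 0`).  In an orthonormal basis of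
eigenvectors this is `∑_k λ_k^s (x, e_k) e_k`.  For `x` outside `D(A^s)` the sum diverges and has
the value `0`; for `A` with compact inverse and `s ≤ 0` it converges for all `x`. -/
def fracPow (A : H →ₗ.[ℝ] H) (s : ℝ) (x : H) : H :=
  ∑' μ : ℝ, (μ ^ s) • (eigenspace A μ).topologicalClosure.starProjection x

/-- The norm `‖x‖_s = ‖A^{s/2} x‖`. -/
def fracNorm (A : H →ₗ.[ℝ] H) (s : ℝ) (x : H) : ℝ :=
  ‖fracPow A (s / 2) x‖

/-- `v` is the solution of the deterministic time-discrete scheme started at `x`: `v_0 = x`,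
`v_n ∈ D(A)` for `n ≥ 1` and
`v_n - v_{n-1} + Δt ∑_{k=1}^n ω_{n-k} A v_k = 0` for `n ≥ 1`
(below both `n` and `k` are shifted by one). -/
def IsDiscreteSolution (b : ℝ → ℝ) (A : H →ₗ.[ℝ] H) (dt : ℝ) (x : H) (v : ℕ → H) : Prop :=
  v 0 = x ∧ ∃ h : ∀ k, v (k + 1) ∈ A.domain, ∀ n : ℕ,
    v (n + 1) - v n +
      dt • ∑ k ∈ Finset.range (n + 1), weight b dt (n - k) • A ⟨v (k + 1), h k⟩ = 0

/-- `B` is the family of time-discrete solution operators: for every `x`, the sequence `B_k x` is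
the one and only solution of the scheme started at `x`.  There is at most one such family. -/
def IsSolutionOperators (b : ℝ → ℝ) (A : H →ₗ.[ℝ] H) (dt : ℝ) (B : ℕ → H →L[ℝ] H) : Prop :=
  ∀ (x : H) (v : ℕ → H), IsDiscreteSolution b A dt x v ↔ ∀ k, v k = B k x

end VolterraEuler

end

/-!
On an eigenvector of `A` with eigenvalue `l` the scheme is scalar, and its solution has generating
function `∑ s_{n+1} z^n = s_0 / (Δt (w + l b̂(w)))` with `w = (1 - z) / Δt` in the right half plane.
Everything rests on the size of the symbol `w + l b̂(w)`:
`KernelAssumption.exists_symbol_ge` states that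
`|w + l b̂(w)|² ≥ c (l ^ (2/ρ) + |w|²)`, uniformly for `l` bounded away from zero.

Since `ρ < 2`, the arguments of `w` and `b̂(w)` differ by an angle bounded away from `π`, so the two
terms of the symbol do not cancel, and it remains to show `|b̂(w)| ≥ c min(1, |w| ^ (1 - ρ))`. For a
nonincreasing convex kernel `|b̂(w)|` is at least a multiple of `∫₀^{1/|w|} b`
(`KernelAssumption.le_norm_laplace`). On the positive axis this integral is comparable with `b̂`
itself, and there `b̂(x) ≥ b̂(1) x ^ (1 - ρ)` for `x ≥ 1`: the power `b̂ ^ (1/(ρ - 1))` maps the right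
half plane to its closure, and the Schwarz lemma applies (`KernelAssumption.laplaceRoot_one_le`).

The bound `|s_n| ≤ |s_0|` is an energy estimate: `Re b̂ ≥ 0` makes the quadrature positive
(`KernelAssumption.quadrature_nonneg`). The bound on `Δt ∑ s_n²` is Bessel's inequality for the
generating function on circles of radius tending to one, combined with the symbol estimate and
`|1 - z| ≥ |θ| / 3` (`KernelAssumption.exists_scalar_sum_sq_le`).

The scheme is uniquely solvable because, in terms of `K = A⁻¹` and the values `A v_n`, each step
inverts `K + Δt ω₀` with `Δt ω₀ > 0`. The compact symmetric operator `K` has a complete system of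
eigenspaces, and Parseval's identity adds up the scalar estimates.
-/

namespace VolterraEuler

/-! ### Oscillatory integrals of convex decreasing functions -/

theorem setIntegral_Ioi_comp_add_right (f : ℝ → ℝ) (a c : ℝ) :
    ∫ t in Ioi a, f (t + c) = ∫ t in Ioi (a + c), f t := by
  have h := (measurePreserving_add_right volume c).setIntegral_preimage_emb
    (measurableEmbedding_addRight c) f (Ioi (a + c))
  simpa using h

theorem integrableOn_Ioi_comp_add_right {f : ℝ → ℝ} {a c : ℝ} (hc : 0 ≤ c)
    (hf : IntegrableOn f (Ioi a)) : IntegrableOn (fun t => f (t + c)) (Ioi a) := by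
  have h := ((measurePreserving_add_right volume c).integrableOn_comp_preimage
    (measurableEmbedding_addRight c) (f := f) (s := Ioi (a + c))).2
    (hf.mono_set (Ioi_subset_Ioi (by linarith)))
  simpa [Function.comp_def] using h

theorem integrableOn_mul_sin {f : ℝ → ℝ} {s : Set ℝ} (hf : IntegrableOn f s) (η : ℝ) :
    IntegrableOn (fun t => f t * Real.sin (η * t)) s :=
  Integrable.mul_bdd (c := 1) hf (by fun_prop)
    (ae_of_all _ fun t => by simpa using Real.abs_sin_le_one _)

theorem integrableOn_mul_cos {f : ℝ → ℝ} {s : Set ℝ} (hf : IntegrableOn f s) (η : ℝ) :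
    IntegrableOn (fun t => f t * Real.cos (η * t)) s :=
  Integrable.mul_bdd (c := 1) hf (by fun_prop)
    (ae_of_all _ fun t => by simpa using Real.abs_cos_le_one _)

/-- On each period `[2πk, 2π(k+1)]` the function `h` is at least its midpoint value where
the sine is nonnegative and at most that value elsewhere, and the sine has mean zero there. -/
theorem integral_mul_sin_nonneg {h : ℝ → ℝ} (hanti : AntitoneOn h (Ioi 0))
    (hint : IntegrableOn h (Ioi 0)) : 0 ≤ ∫ t in Ioi 0, h t * Real.sin t := by
  have hpi := Real.pi_pos
  have hint' : IntegrableOn (fun t => h t * Real.sin t) (Ioi 0) := by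
    simpa using integrableOn_mul_sin hint 1
  have hlim : Tendsto (fun n : ℕ => ∫ t in (0 : ℝ)..((n : ℝ) * (2 * Real.pi)), h t * Real.sin t)
      atTop (𝓝 (∫ t in Ioi 0, h t * Real.sin t)) :=
    intervalIntegral_tendsto_integral_Ioi 0 hint'
      (tendsto_natCast_atTop_atTop.atTop_mul_const (by positivity))
  refine ge_of_tendsto' hlim fun n => ?_
  have hii : ∀ f : ℝ → ℝ, IntegrableOn f (Ioi 0) → ∀ k : ℕ,
      IntervalIntegrable f volume ((k : ℝ) * (2 * Real.pi)) (((k + 1 : ℕ) : ℝ) * (2 * Real.pi)) := by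
    intro f hf k
    rw [intervalIntegrable_iff_integrableOn_Ioc_of_le
      (by gcongr; linarith [(Nat.cast_succ k : ((k + 1 : ℕ) : ℝ) = k + 1)])]
    refine hf.mono_set fun t ht => ?_
    exact lt_of_le_of_lt (by positivity) ht.1
  have hsum := intervalIntegral.sum_integral_adjacent_intervals
    (f := fun t => h t * Real.sin t) (a := fun k : ℕ => (k : ℝ) * (2 * Real.pi)) (n := n)
    (fun k _ => hii _ hint' k)
  simp only [Nat.cast_zero, zero_mul] at hsum
  rw [← hsum]
  refine Finset.sum_nonneg fun k _ => ?_
  set m : ℝ := (k : ℝ) * (2 * Real.pi) + Real.pi with hm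
  have hm0 : 0 < m := by positivity
  have hzero : ∫ t in ((k : ℝ) * (2 * Real.pi))..(((k + 1 : ℕ) : ℝ) * (2 * Real.pi)),
      h m * Real.sin t = 0 := by
    rw [intervalIntegral.integral_const_mul, integral_sin, Real.cos_nat_mul_two_pi,
      Real.cos_nat_mul_two_pi, sub_self, mul_zero]
  have hle : (k : ℝ) * (2 * Real.pi) ≤ ((k + 1 : ℕ) : ℝ) * (2 * Real.pi) := by
    gcongr; linarith [(Nat.cast_succ k : ((k + 1 : ℕ) : ℝ) = k + 1)]
  have hsub : 0 ≤ ∫ t in ((k : ℝ) * (2 * Real.pi))..(((k + 1 : ℕ) : ℝ) * (2 * Real.pi)),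
      (h t * Real.sin t - h m * Real.sin t) := by
    rw [intervalIntegral.integral_of_le hle]
    refine setIntegral_nonneg measurableSet_Ioc fun t ht => ?_
    have ht0 : 0 < t := lt_of_le_of_lt (by positivity) ht.1
    have ht2 : t ≤ (k : ℝ) * (2 * Real.pi) + 2 * Real.pi := by
      have := ht.2; push_cast at this; linarith
    rw [← sub_mul]
    rcases le_total t m with htm | htm
    · refine mul_nonneg (sub_nonneg.2 (hanti ht0 hm0 htm)) ?_
      rw [← Real.sin_sub_nat_mul_two_pi t k]
      exact Real.sin_nonneg_of_nonneg_of_le_pi (by linarith [ht.1]) (by linarith)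
    · refine mul_nonneg_of_nonpos_of_nonpos (sub_nonpos.2 (hanti hm0 ht0 htm)) ?_
      rw [← Real.sin_sub_nat_mul_two_pi t k, ← Real.sin_sub_two_pi]
      exact Real.sin_nonpos_of_nonpos_of_neg_pi_le (by linarith) (by linarith)
  rw [intervalIntegral.integral_sub (hii _ hint' k)
    (Continuous.intervalIntegrable (by fun_prop) _ _), hzero, sub_zero] at hsub
  exact hsub

theorem setIntegral_Ioi_eq_add {f : ℝ → ℝ} {c : ℝ} (hc : 0 ≤ c) (hf : IntegrableOn f (Ioi 0)) :
    ∫ t in Ioi 0, f t = (∫ t in Ioc 0 c, f t) + ∫ t in Ioi c, f t := by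
  rw [← Ioc_union_Ioi_eq_Ioi hc]
  refine setIntegral_union (Ioc_disjoint_Ioi le_rfl) measurableSet_Ioi ?_ ?_
  · exact hf.mono_set Ioc_subset_Ioi_self
  · exact hf.mono_set (Ioi_subset_Ioi hc)

theorem antitoneOn_sub_shift {g : ℝ → ℝ} (hconv : ConvexOn ℝ (Ioi 0) g) {c : ℝ}
    (hc : 0 < c) : AntitoneOn (fun t => g t - g (t + c)) (Ioi 0) := by
  intro s hs t ht hst
  have hs' : 0 < s := hs
  have htc : t + c ∈ Ioi (0 : ℝ) := add_pos ht hc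
  have hd : 0 < t - s + c := by linarith
  have hp : 0 ≤ c / (t - s + c) := by positivity
  have hq : 0 ≤ (t - s) / (t - s + c) := div_nonneg (by linarith) hd.le
  have h1 := hconv.2 hs htc hp hq (by field_simp; ring)
  have h2 := hconv.2 hs htc hq hp (by field_simp)
  have e1 : (c / (t - s + c)) • s + ((t - s) / (t - s + c)) • (t + c) = t := by
    simp only [smul_eq_mul]; field_simp; ring
  have e2 : ((t - s) / (t - s + c)) • s + (c / (t - s + c)) • (t + c) = s + c := by
    simp only [smul_eq_mul]; field_simp; ring
  rw [e1] at h1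
  rw [e2] at h2
  have e3 : (c / (t - s + c)) + ((t - s) / (t - s + c)) = 1 := by field_simp; ring
  simp only [smul_eq_mul] at h1 h2
  have : g t + g (s + c) ≤
      ((c / (t - s + c)) + ((t - s) / (t - s + c))) * (g s + g (t + c)) := by linarith
  rw [e3] at this
  simp only
  linarith

/-- With `I = ∫₀^∞ g sin` and `J = ∫₀^∞ g(· + π) sin` one has `I + J = ∫₀^π g sin`, while
`I - J ≥ 0` since `g - g(· + π)` is nonincreasing. -/
theorem integral_mul_sin_ge {g : ℝ → ℝ} (hconv : ConvexOn ℝ (Ioi 0) g)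
    (hint : IntegrableOn g (Ioi 0)) :
    ∫ t in Ioc 0 Real.pi, g t * Real.sin t ≤ 2 * ∫ t in Ioi 0, g t * Real.sin t := by
  have hpi := Real.pi_pos
  have hint' : IntegrableOn (fun t => g t * Real.sin t) (Ioi 0) := by
    simpa using integrableOn_mul_sin hint 1
  have hshift : IntegrableOn (fun t => g (t + Real.pi)) (Ioi 0) :=
    integrableOn_Ioi_comp_add_right hpi.le hint
  have hshift' : IntegrableOn (fun t => g (t + Real.pi) * Real.sin t) (Ioi 0) := by
    simpa using integrableOn_mul_sin hshift 1
  have h1 := integral_mul_sin_nonneg (antitoneOn_sub_shift hconv hpi) (hint.sub hshift)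
  simp only [sub_mul] at h1
  rw [integral_sub hint' hshift'] at h1
  have h2 := setIntegral_Ioi_comp_add_right (fun t => g t * Real.sin t) 0 Real.pi
  simp only [Real.sin_add_pi, mul_neg, zero_add] at h2
  rw [integral_neg] at h2
  have h3 := setIntegral_Ioi_eq_add hpi.le hint'
  linarith

theorem integral_mul_sin_le {g : ℝ → ℝ} (hanti : AntitoneOn g (Ioi 0))
    (hint : IntegrableOn g (Ioi 0)) :
    ∫ t in Ioi 0, g t * Real.sin t ≤ ∫ t in Ioc 0 Real.pi, g t * Real.sin t := by
  have hpi := Real.pi_pos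
  have hint' : IntegrableOn (fun t => g t * Real.sin t) (Ioi 0) := by
    simpa using integrableOn_mul_sin hint 1
  have h1 := integral_mul_sin_nonneg (h := fun t => g (t + Real.pi))
    (fun s hs t ht hst => hanti (add_pos hs hpi) (add_pos ht hpi) (by linarith))
    (integrableOn_Ioi_comp_add_right hpi.le hint)
  have h2 := setIntegral_Ioi_comp_add_right (fun t => g t * Real.sin t) 0 Real.pi
  simp only [Real.sin_add_pi, mul_neg, zero_add] at h2
  rw [integral_neg] at h2
  have h3 := setIntegral_Ioi_eq_add hpi.le hint'
  linarith

/-- A quantitative lower bound at frequency one. The sine integral controls `g (π/2)`, which is all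
that the cosine integral can lose to the range `t > π/2`. -/
theorem integral_cos_add_sin_ge {g : ℝ → ℝ} (hnn : ∀ t, 0 < t → 0 ≤ g t)
    (hanti : AntitoneOn g (Ioi 0)) (hconv : ConvexOn ℝ (Ioi 0) g)
    (hint : IntegrableOn g (Ioi 0)) :
    Real.cos 1 * ∫ t in Ioc 0 1, g t ≤
      (∫ t in Ioi 0, g t * Real.cos t) + 8 * ∫ t in Ioi 0, g t * Real.sin t := by
  have hpi := Real.pi_pos
  have hpi3 := Real.pi_gt_three
  have hS : IntegrableOn (fun t => g t * Real.sin t) (Ioi 0) := by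
    simpa using integrableOn_mul_sin hint 1
  have hC : IntegrableOn (fun t => g t * Real.cos t) (Ioi 0) := by
    simpa using integrableOn_mul_cos hint 1
  set q := g (Real.pi / 2) with hq
  have hq0 : 0 ≤ q := hnn _ (by positivity)
  -- the sine integral bounds `q`
  have hs : q ≤ 2 * ∫ t in Ioi 0, g t * Real.sin t := by
    refine le_trans ?_ (integral_mul_sin_ge hconv hint)
    have hone : ∫ t in Ioc 0 (Real.pi / 2), q * Real.sin t = q := by
      rw [← intervalIntegral.integral_of_le (by positivity), intervalIntegral.integral_const_mul,
        integral_sin]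
      simp
    have hstep : ∫ t in Ioc 0 (Real.pi / 2), q * Real.sin t ≤
        ∫ t in Ioc 0 (Real.pi / 2), g t * Real.sin t := by
      refine setIntegral_mono_on ?_ (hS.mono_set Ioc_subset_Ioi_self) measurableSet_Ioc ?_
      · exact (Continuous.integrableOn_Icc (by fun_prop)).mono_set Ioc_subset_Icc_self
      · intro t ht
        refine mul_le_mul_of_nonneg_right (hanti ht.1 (mem_Ioi.2 (by positivity)) ht.2) ?_
        exact Real.sin_nonneg_of_nonneg_of_le_pi ht.1.le (by linarith [ht.2])
    rw [hone] at hstep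
    refine hstep.trans (setIntegral_mono_set (hS.mono_set Ioc_subset_Ioi_self) ?_ ?_)
    · refine (ae_restrict_iff' measurableSet_Ioc).2 (ae_of_all _ fun t ht => ?_)
      exact mul_nonneg (hnn t ht.1) (Real.sin_nonneg_of_nonneg_of_le_pi ht.1.le ht.2)
    · exact (Ioc_subset_Ioc_right (by linarith)).eventuallyLE
  -- the tail of the cosine integral
  have htail : -(2 * q) ≤ ∫ t in Ioi (Real.pi / 2), g t * Real.cos t := by
    have h2 := setIntegral_Ioi_comp_add_right (fun t => g t * Real.cos t) 0 (Real.pi / 2)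
    simp only [Real.cos_add_pi_div_two, mul_neg, zero_add] at h2
    rw [← h2, integral_neg, neg_le_neg_iff]
    have hsh := integrableOn_Ioi_comp_add_right (c := Real.pi / 2) (by positivity) hint
    refine (integral_mul_sin_le (g := fun t => g (t + Real.pi / 2)) (fun s hs t ht hst =>
      hanti (add_pos hs (half_pos hpi)) (add_pos ht (half_pos hpi)) (by linarith)) hsh).trans ?_
    have hone : ∫ t in Ioc 0 Real.pi, q * Real.sin t = 2 * q := by
      rw [← intervalIntegral.integral_of_le (by positivity), intervalIntegral.integral_const_mul,
        integral_sin]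
      simp; ring
    rw [← hone]
    refine setIntegral_mono_on ?_ ?_ measurableSet_Ioc ?_
    · have := integrableOn_mul_sin hsh 1
      simp only [one_mul] at this
      exact this.mono_set Ioc_subset_Ioi_self
    · exact (Continuous.integrableOn_Icc (by fun_prop)).mono_set Ioc_subset_Icc_self
    · intro t ht
      refine mul_le_mul_of_nonneg_right (hanti (mem_Ioi.2 (by positivity))
        (mem_Ioi.2 (by linarith [ht.1])) (by linarith [ht.1])) ?_
      exact Real.sin_nonneg_of_nonneg_of_le_pi ht.1.le ht.2
  have hsplit := setIntegral_Ioi_eq_add (c := Real.pi / 2) (by positivity) hC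
  have hhead : Real.cos 1 * ∫ t in Ioc 0 1, g t ≤
      ∫ t in Ioc 0 (Real.pi / 2), g t * Real.cos t := by
    rw [← integral_const_mul]
    refine le_trans (setIntegral_mono_on (g := fun t => g t * Real.cos t)
      ((hint.mono_set Ioc_subset_Ioi_self).const_mul _)
      (hC.mono_set Ioc_subset_Ioi_self) measurableSet_Ioc ?_)
      (setIntegral_mono_set (hC.mono_set Ioc_subset_Ioi_self) ?_ ?_)
    · intro t ht
      rw [mul_comm]
      refine mul_le_mul_of_nonneg_left ?_ (hnn t ht.1)
      exact Real.cos_le_cos_of_nonneg_of_le_pi ht.1.le (by linarith) ht.2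
    · refine (ae_restrict_iff' measurableSet_Ioc).2 (ae_of_all _ fun t ht => ?_)
      exact mul_nonneg (hnn t ht.1) (Real.cos_nonneg_of_neg_pi_div_two_le_of_le
        (by linarith [ht.1]) ht.2)
    · exact (Ioc_subset_Ioc_right (by linarith)).eventuallyLE
  linarith

theorem integral_cos_add_sin_ge_of_pos {g : ℝ → ℝ} (hnn : ∀ t, 0 < t → 0 ≤ g t)
    (hanti : AntitoneOn g (Ioi 0)) (hconv : ConvexOn ℝ (Ioi 0) g)
    (hint : IntegrableOn g (Ioi 0)) {η : ℝ} (hη : 0 < η) :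
    Real.cos 1 * ∫ t in Ioc 0 η⁻¹, g t ≤
      (∫ t in Ioi 0, g t * Real.cos (η * t)) + 8 * ∫ t in Ioi 0, g t * Real.sin (η * t) := by
  have hη' : 0 < η⁻¹ := inv_pos.2 hη
  have h := integral_cos_add_sin_ge (g := fun t => g (η⁻¹ * t))
    (fun t ht => hnn _ (by positivity))
    (fun s hs t ht hst => hanti (mul_pos hη' hs) (mul_pos hη' ht) (by gcongr))
    (by
      refine ⟨convex_Ioi 0, fun s hs t ht a b ha hb hab => ?_⟩
      have := hconv.2 (mul_pos hη' hs) (mul_pos hη' ht) ha hb hab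
      simp only [smul_eq_mul] at this ⊢
      convert this using 2
      ring)
    (by
      have := (integrableOn_Ioi_comp_mul_left_iff g 0 hη').2 (by simpa using hint)
      simpa using this)
  have e1 := integral_comp_mul_left_Ioi (fun t => g t * Real.cos (η * t)) 0 hη'
  have e2 := integral_comp_mul_left_Ioi (fun t => g t * Real.sin (η * t)) 0 hη'
  simp only [mul_inv_cancel_left₀ hη.ne', mul_zero, smul_eq_mul] at e1 e2
  have e3 : ∫ t in Ioc 0 1, g (η⁻¹ * t) = η * ∫ t in Ioc 0 η⁻¹, g t := by
    rw [← intervalIntegral.integral_of_le zero_le_one, ← intervalIntegral.integral_of_le hη'.le,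
      intervalIntegral.integral_comp_mul_left _ hη'.ne']
    simp
  rw [e1, e2, e3] at h
  rw [inv_inv] at h
  refine le_of_mul_le_mul_left ?_ hη
  linarith

/-! ### The Laplace transform of the kernel -/

variable {b : ℝ → ℝ}

theorem KernelAssumption.integrableOn_Ioc (hb : KernelAssumption b) (T : ℝ) :
    IntegrableOn b (Ioc 0 T) :=
  (hb.locallyIntegrableOn.integrableOn_compact_subset Icc_subset_Ici_self isCompact_Icc).mono_set
    Ioc_subset_Icc_self

theorem KernelAssumption.aestronglyMeasurable (hb : KernelAssumption b) :
    AEStronglyMeasurable b (volume.restrict (Ioi 0)) :=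
  hb.locallyIntegrableOn.aestronglyMeasurable.mono_measure
    (Measure.restrict_mono Ioi_subset_Ici_self le_rfl)

theorem integrableOn_exp_neg_mul {x : ℝ} (hx : 0 < x) (a : ℝ) :
    IntegrableOn (fun t => Real.exp (-x * t)) (Ioi a) :=
  integrableOn_exp_mul_Ioi (by linarith) a

theorem KernelAssumption.integrableOn_mul_exp (hb : KernelAssumption b) {x : ℝ} (hx : 0 < x) :
    IntegrableOn (fun t => b t * Real.exp (-x * t)) (Ioi 0) := by
  have hmeas : AEStronglyMeasurable (fun t => b t * Real.exp (-x * t))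
      (volume.restrict (Ioi 0)) :=
    hb.aestronglyMeasurable.mul (by fun_prop)
  rw [← Ioc_union_Ioi_eq_Ioi zero_le_one]
  refine IntegrableOn.union ?_ ?_
  · refine Integrable.mul_bdd (c := 1) (hb.integrableOn_Ioc 1) (by fun_prop) ?_
    refine (ae_restrict_iff' measurableSet_Ioc).2 (ae_of_all _ fun t ht => ?_)
    rw [Real.norm_eq_abs, Real.abs_exp, Real.exp_le_one_iff]
    nlinarith [ht.1]
  · refine Integrable.mono' ((integrableOn_exp_neg_mul hx 1).const_mul (b 1))
      (hmeas.mono_measure (Measure.restrict_mono (Ioi_subset_Ioi zero_le_one) le_rfl)) ?_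
    refine (ae_restrict_iff' measurableSet_Ioi).2 (ae_of_all _ fun t ht => ?_)
    have ht0 : (0 : ℝ) < t := zero_lt_one.trans ht
    rw [norm_mul, Real.norm_eq_abs, Real.norm_eq_abs, Real.abs_exp,
      abs_of_nonneg (hb.threeMonotone.nonneg t ht0)]
    gcongr
    exact hb.threeMonotone.antitoneOn (mem_Ioi.2 zero_lt_one) ht0 (le_of_lt ht)

theorem norm_exp_neg_mul_ofReal (z : ℂ) (t : ℝ) :
    ‖Complex.exp (-z * (t : ℂ))‖ = Real.exp (-z.re * t) := by
  rw [Complex.norm_exp]; simp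

theorem KernelAssumption.integrableOn_laplace (hb : KernelAssumption b) {z : ℂ} (hz : 0 < z.re) :
    IntegrableOn (fun t => (b t : ℂ) * Complex.exp (-z * (t : ℂ))) (Ioi 0) := by
  have hm : AEStronglyMeasurable (fun t => (b t : ℂ)) (volume.restrict (Ioi 0)) :=
    Complex.continuous_ofReal.comp_aestronglyMeasurable hb.aestronglyMeasurable
  refine Integrable.mono (hb.integrableOn_mul_exp hz) (hm.mul (by fun_prop)) ?_
  refine ae_of_all _ fun t => ?_
  rw [norm_mul, norm_mul, norm_exp_neg_mul_ofReal, Complex.norm_real, Real.norm_eq_abs (Real.exp _),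
    Real.abs_exp]

theorem KernelAssumption.differentiableAt_laplace (hb : KernelAssumption b) {z : ℂ}
    (hz : 0 < z.re) : DifferentiableAt ℂ (laplace b) z := by
  have hm : AEStronglyMeasurable (fun t => (b t : ℂ)) (volume.restrict (Ioi 0)) :=
    Complex.continuous_ofReal.comp_aestronglyMeasurable hb.aestronglyMeasurable
  have hball : ∀ w ∈ Metric.ball z (z.re / 2), z.re / 2 < w.re := by
    intro w hw
    have h1 := (Complex.abs_re_le_norm (w - z)).trans_lt (mem_ball_iff_norm.1 hw)
    rw [Complex.sub_re, abs_lt] at h1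
    linarith [h1.1]
  refine (hasDerivAt_integral_of_dominated_loc_of_deriv_le
    (μ := volume.restrict (Ioi 0)) (F := fun w t => (b t : ℂ) * Complex.exp (-w * (t : ℂ)))
    (F' := fun w t => (b t : ℂ) * (Complex.exp (-w * (t : ℂ)) * -(t : ℂ)))
    (bound := fun t => 4 / z.re * ‖b t * Real.exp (-(z.re / 4) * t)‖)
    (Metric.ball_mem_nhds z (half_pos hz)) ?_ (hb.integrableOn_laplace hz) ?_ ?_ ?_ ?_).2
    |>.differentiableAt
  · exact Eventually.of_forall fun w => hm.mul (by fun_prop)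
  · exact hm.mul (by fun_prop)
  · refine (ae_restrict_iff' measurableSet_Ioi).2 (ae_of_all _ fun t ht w hw => ?_)
    have ht0 : (0 : ℝ) < t := ht
    rw [norm_mul, norm_mul, norm_mul, norm_exp_neg_mul_ofReal, norm_neg, Complex.norm_real,
      Complex.norm_real, Real.norm_eq_abs (Real.exp _), Real.abs_exp, Real.norm_eq_abs t,
      abs_of_pos ht0]
    have h1 : t ≤ 4 / z.re * Real.exp (z.re / 4 * t) := by
      have := Real.add_one_le_exp (z.re / 4 * t)
      calc t = 4 / z.re * (z.re / 4 * t) := by field_simp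
        _ ≤ _ := by gcongr; linarith
    have h2 : Real.exp (-w.re * t) ≤ Real.exp (-(z.re / 2) * t) := by
      have := hball w hw
      gcongr
    calc ‖b t‖ * (Real.exp (-w.re * t) * t)
        ≤ ‖b t‖ * (Real.exp (-(z.re / 2) * t) * (4 / z.re * Real.exp (z.re / 4 * t))) := by
          gcongr
      _ = 4 / z.re * (‖b t‖ * (Real.exp (-(z.re / 2) * t) * Real.exp (z.re / 4 * t))) := by ring
      _ = 4 / z.re * (‖b t‖ * Real.exp (-(z.re / 4) * t)) := by
          rw [← Real.exp_add]; ring_nf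
  · exact (hb.integrableOn_mul_exp (by positivity)).norm.const_mul _
  · refine ae_of_all _ fun t w _ => ?_
    have h1 : HasDerivAt (fun w : ℂ => -w * (t : ℂ)) (-(t : ℂ)) w := by
      simpa using (hasDerivAt_id w).neg.mul_const (t : ℂ)
    exact h1.cexp.const_mul _

theorem laplace_conj (b : ℝ → ℝ) (z : ℂ) :
    laplace b ((starRingEnd ℂ) z) = (starRingEnd ℂ) (laplace b z) := by
  unfold laplace
  rw [← integral_conj]
  congr 1 with t
  simp [← Complex.exp_conj]

theorem KernelAssumption.laplace_re (hb : KernelAssumption b) {z : ℂ} (hz : 0 < z.re) :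
    (laplace b z).re = ∫ t in Ioi 0, b t * Real.exp (-z.re * t) * Real.cos (z.im * t) := by
  have h := Complex.reCLM.integral_comp_comm (hb.integrableOn_laplace hz)
  simp only [Complex.reCLM_apply] at h
  rw [laplace, ← h]
  congr 1 with t
  simp [Complex.exp_re, mul_assoc]

theorem KernelAssumption.laplace_im (hb : KernelAssumption b) {z : ℂ} (hz : 0 < z.re) :
    -(laplace b z).im = ∫ t in Ioi 0, b t * Real.exp (-z.re * t) * Real.sin (z.im * t) := by
  have h := Complex.imCLM.integral_comp_comm (hb.integrableOn_laplace hz)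
  simp only [Complex.imCLM_apply] at h
  rw [laplace, ← h, ← integral_neg]
  congr 1 with t
  simp [Complex.exp_im, mul_assoc]

theorem KernelAssumption.laplace_ofReal (hb : KernelAssumption b) {x : ℝ} (hx : 0 < x) :
    laplace b x = ((∫ t in Ioi 0, b t * Real.exp (-x * t) : ℝ) : ℂ) := by
  apply Complex.ext
  · rw [hb.laplace_re (by simpa using hx)]; simp
  · rw [← neg_inj, hb.laplace_im (by simpa using hx)]; simp

theorem KernelAssumption.integral_Ioc_pos (hb : KernelAssumption b) {T : ℝ} (hT : 0 < T) :
    0 < ∫ t in Ioc 0 T, b t := by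
  -- `b ≥ b t₀ > 0` on `(0, t₀]`
  obtain ⟨t₀, ht₀, hne⟩ := hb.ne_zero
  have hpos : 0 < b t₀ := lt_of_le_of_ne (hb.threeMonotone.nonneg t₀ ht₀) hne.symm
  set m := min t₀ T with hm
  have hm0 : 0 < m := lt_min ht₀ hT
  have h1 : ∫ _ in Ioc 0 m, b t₀ ≤ ∫ t in Ioc 0 m, b t := by
    refine setIntegral_mono_on (integrableOn_const (by simp)) (hb.integrableOn_Ioc m)
      measurableSet_Ioc fun t ht => ?_
    exact hb.threeMonotone.antitoneOn (mem_Ioi.2 ht.1) ht₀ (ht.2.trans (min_le_left _ _))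
  have h2 : ∫ t in Ioc 0 m, b t ≤ ∫ t in Ioc 0 T, b t := by
    refine setIntegral_mono_set (hb.integrableOn_Ioc T) ?_
      (Ioc_subset_Ioc_right (min_le_right _ _)).eventuallyLE
    exact (ae_restrict_iff' measurableSet_Ioc).2
      (ae_of_all _ fun t ht => hb.threeMonotone.nonneg t ht.1)
  have h3 : ∫ _ in Ioc 0 m, b t₀ = m * b t₀ := by
    simp [hm0.le]
  nlinarith [mul_pos hm0 hpos]

theorem exp_neg_one_mul_integral_le (hb : KernelAssumption b) {x T S : ℝ} (hx : 0 < x)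
    (hxT : x * T ≤ 1) (hTS : T ≤ S) :
    Real.exp (-1) * ∫ t in Ioc 0 T, b t ≤ ∫ t in Ioc 0 S, b t * Real.exp (-x * t) := by
  have hint := (hb.integrableOn_mul_exp hx).mono_set (Ioc_subset_Ioi_self (a := S) (b := 0))
  rw [← integral_const_mul]
  refine le_trans (setIntegral_mono_on (g := fun t => b t * Real.exp (-x * t))
    ((hb.integrableOn_Ioc T).const_mul _)
    (hint.mono_set (Ioc_subset_Ioc_right hTS)) measurableSet_Ioc ?_)
    (setIntegral_mono_set hint ?_ (Ioc_subset_Ioc_right hTS).eventuallyLE)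
  · intro t ht
    rw [mul_comm]
    refine mul_le_mul_of_nonneg_left ?_ (hb.threeMonotone.nonneg t ht.1)
    rw [Real.exp_le_exp]
    nlinarith [ht.1, ht.2]
  · exact (ae_restrict_iff' measurableSet_Ioc).2
      (ae_of_all _ fun t ht => mul_nonneg (hb.threeMonotone.nonneg t ht.1) (Real.exp_pos _).le)

theorem KernelAssumption.convexOn_mul_exp (hb : KernelAssumption b) {x : ℝ} (hx : 0 < x) :
    AntitoneOn (fun t => b t * Real.exp (-x * t)) (Ioi 0) ∧
      ConvexOn ℝ (Ioi 0) (fun t => b t * Real.exp (-x * t)) := by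
  have hexp : Antitone fun t : ℝ => Real.exp (-x * t) := fun s t hst => by
    simp only [Real.exp_le_exp]; nlinarith
  refine ⟨fun s hs t ht hst => mul_le_mul (hb.threeMonotone.antitoneOn hs ht hst) (hexp hst)
    (Real.exp_pos _).le (hb.threeMonotone.nonneg s hs), ?_⟩
  refine ConvexOn.mul (𝕜 := ℝ) hb.threeMonotone.convexOn ?_
    (fun t ht => hb.threeMonotone.nonneg t ht) (fun t _ => (Real.exp_pos _).le) ?_
  · have h := (convexOn_exp.comp_linearMap ((-x) • LinearMap.id)).subset
      (subset_univ (Ioi 0)) (convex_Ioi 0)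
    simpa [Function.comp_def] using h
  · exact (hb.threeMonotone.antitoneOn).monovaryOn (hexp.antitoneOn _)

/-- For a nonincreasing convex kernel, `|b̂(z)|` is bounded below by the mass of `b` on `(0, 1/|z|)`,
uniformly up to the imaginary axis. -/
theorem KernelAssumption.le_norm_laplace (hb : KernelAssumption b) {z : ℂ} (hz : 0 < z.re) :
    Real.cos 1 * Real.exp (-1) / 9 * ∫ t in Ioc 0 ‖z‖⁻¹, b t ≤ ‖laplace b z‖ := by
  have hcos : 0 < Real.cos 1 := Real.cos_one_pos
  have hz0 : 0 < ‖z‖ := hz.trans_le ((le_abs_self _).trans (Complex.abs_re_le_norm z))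
  have hzre : z.re * ‖z‖⁻¹ ≤ 1 := by
    rw [← div_eq_mul_inv, div_le_one hz0]; exact Complex.re_le_norm z
  have key : ∀ w : ℂ, 0 < w.re → 0 < w.im →
      Real.cos 1 * Real.exp (-1) / 9 * ∫ t in Ioc 0 ‖w‖⁻¹, b t ≤ ‖laplace b w‖ := by
    intro w hw hwi
    have hw0 : 0 < ‖w‖ := hw.trans_le ((le_abs_self _).trans (Complex.abs_re_le_norm w))
    have hwre : w.re * ‖w‖⁻¹ ≤ 1 := by
      rw [← div_eq_mul_inv, div_le_one hw0]; exact Complex.re_le_norm w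
    obtain ⟨hanti, hconv⟩ := hb.convexOn_mul_exp hw
    have h1 := integral_cos_add_sin_ge_of_pos
      (fun t ht => mul_nonneg (hb.threeMonotone.nonneg t ht) (Real.exp_pos (-w.re * t)).le)
      hanti hconv (hb.integrableOn_mul_exp hw) hwi
    rw [← hb.laplace_re hw, ← hb.laplace_im hw] at h1
    have h2 := exp_neg_one_mul_integral_le hb hw hwre (S := w.im⁻¹)
      (by gcongr; exact (le_abs_self _).trans (Complex.abs_im_le_norm w))
    have h3 := Complex.re_le_norm (laplace b w)
    have h4 := (neg_le_abs _).trans (Complex.abs_im_le_norm (laplace b w))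
    have h5 := mul_le_mul_of_nonneg_left h2 hcos.le
    linarith
  rcases lt_trichotomy z.im 0 with him | him | him
  · have h := key ((starRingEnd ℂ) z) (by simpa using hz) (by simpa using him)
    rwa [laplace_conj, RCLike.norm_conj, RCLike.norm_conj] at h
  · have h2 := exp_neg_one_mul_integral_le hb hz hzre le_rfl
    have h3 : ∫ t in Ioc 0 ‖z‖⁻¹, b t * Real.exp (-z.re * t) ≤ (laplace b z).re := by
      rw [hb.laplace_re hz, him]
      simp only [zero_mul, Real.cos_zero, mul_one]
      refine setIntegral_mono_set (hb.integrableOn_mul_exp hz) ?_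
        Ioc_subset_Ioi_self.eventuallyLE
      exact (ae_restrict_iff' measurableSet_Ioi).2
        (ae_of_all _ fun t ht => mul_nonneg (hb.threeMonotone.nonneg t ht) (Real.exp_pos _).le)
    have h4 := Complex.re_le_norm (laplace b z)
    have h5 : 0 ≤ Real.exp (-1) * ∫ t in Ioc 0 ‖z‖⁻¹, b t :=
      mul_nonneg (Real.exp_pos _).le (hb.integral_Ioc_pos (inv_pos.2 hz0)).le
    have h6 := Real.cos_le_one 1
    nlinarith
  · exact key z hz him

/-- A converse to `KernelAssumption.le_norm_laplace` on the positive axis. -/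
theorem KernelAssumption.laplace_le (hb : KernelAssumption b) {x : ℝ} (hx : 0 < x) :
    (laplace b x).re ≤ 2 * ∫ t in Ioc 0 x⁻¹, b t := by
  have hx' : 0 < x⁻¹ := inv_pos.2 hx
  have hint := hb.integrableOn_mul_exp hx
  rw [hb.laplace_ofReal hx, Complex.ofReal_re, setIntegral_Ioi_eq_add hx'.le hint, two_mul]
  refine add_le_add ?_ ?_
  · refine setIntegral_mono_on (hint.mono_set Ioc_subset_Ioi_self) (hb.integrableOn_Ioc _)
      measurableSet_Ioc fun t ht => ?_
    refine mul_le_of_le_one_right (hb.threeMonotone.nonneg t ht.1) ?_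
    rw [Real.exp_le_one_iff]; nlinarith [ht.1]
  -- the tail is at most `b (1/x) / x`, which is at most the mass of `b` on `(0, 1/x)`
  · have h1 : ∫ t in Ioi x⁻¹, b t * Real.exp (-x * t) ≤
        ∫ t in Ioi x⁻¹, b x⁻¹ * Real.exp (-x * t) := by
      refine setIntegral_mono_on (hint.mono_set (Ioi_subset_Ioi hx'.le))
        ((integrableOn_exp_neg_mul hx _).const_mul _) measurableSet_Ioi fun t ht => ?_
      gcongr
      exact hb.threeMonotone.antitoneOn hx' (hx'.trans ht) (le_of_lt ht)
    have h2 : ∫ t in Ioi x⁻¹, b x⁻¹ * Real.exp (-x * t) ≤ x⁻¹ * b x⁻¹ := by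
      rw [integral_const_mul, integral_exp_mul_Ioi (by linarith)]
      have h3 : Real.exp (-x * x⁻¹) ≤ 1 := by
        rw [Real.exp_le_one_iff]; nlinarith
      have h4 : -Real.exp (-x * x⁻¹) / -x = Real.exp (-x * x⁻¹) * x⁻¹ := by
        rw [neg_div_neg_eq, div_eq_mul_inv]
      rw [h4]
      have h5 := hb.threeMonotone.nonneg _ hx'
      have := mul_le_mul_of_nonneg_right h3 (mul_nonneg hx'.le h5)
      linarith
    have h3 : x⁻¹ * b x⁻¹ = ∫ _ in Ioc 0 x⁻¹, b x⁻¹ := by simp [hx'.le]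
    rw [h3] at h2
    refine h1.trans (h2.trans ?_)
    refine setIntegral_mono_on (integrableOn_const (by simp)) (hb.integrableOn_Ioc _)
      measurableSet_Ioc fun t ht => ?_
    exact hb.threeMonotone.antitoneOn (mem_Ioi.2 ht.1) hx' ht.2

/-! ### The sector condition -/

theorem KernelAssumption.laplace_ne_zero (hb : KernelAssumption b) {z : ℂ} (hz : 0 < z.re) :
    laplace b z ≠ 0 := by
  have hz0 : 0 < ‖z‖ := hz.trans_le ((le_abs_self _).trans (Complex.abs_re_le_norm z))
  have h := hb.le_norm_laplace hz
  have h2 := hb.integral_Ioc_pos (inv_pos.2 hz0)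
  have h3 : 0 < Real.cos 1 := Real.cos_one_pos
  exact norm_pos_iff.1 (lt_of_lt_of_le (by positivity) h)

theorem abs_arg_laplace_le (b : ℝ → ℝ) {z : ℂ} (hz : 0 < z.re) :
    |Complex.arg (laplace b z)| ≤ (rho b - 1) * (Real.pi / 2) := by
  have hpi := Real.pi_pos
  have h : |Complex.arg (laplace b z)| ≤
      sSup {θ : ℝ | ∃ z : ℂ, 0 < z.re ∧ θ = |Complex.arg (laplace b z)|} := by
    refine le_csSup ⟨Real.pi, ?_⟩ ⟨z, hz, rfl⟩
    rintro _ ⟨w, _, rfl⟩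
    exact Complex.abs_arg_le_pi _
  refine h.trans (le_of_eq ?_)
  unfold rho
  field_simp
  ring

theorem KernelAssumption.abs_arg_lt (hb : KernelAssumption b) {z : ℂ} (hz : 0 < z.re) :
    |Complex.arg (laplace b z)| < Real.pi / 2 := by
  have hpi := Real.pi_pos
  have := abs_arg_laplace_le b hz
  have := hb.rho_lt_two
  nlinarith

theorem KernelAssumption.laplace_re_pos (hb : KernelAssumption b) {z : ℂ} (hz : 0 < z.re) :
    0 < (laplace b z).re := by
  rw [← Complex.norm_mul_cos_arg]
  have h := abs_lt.1 (hb.abs_arg_lt hz)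
  exact mul_pos (norm_pos_iff.2 (hb.laplace_ne_zero hz)) (Real.cos_pos_of_mem_Ioo h)

theorem KernelAssumption.abs_laplace_im_le (hb : KernelAssumption b) {z : ℂ} (hz : 0 < z.re) :
    |(laplace b z).im| ≤ Real.sin ((rho b - 1) * (Real.pi / 2)) * ‖laplace b z‖ := by
  have hpi := Real.pi_pos
  have h1 := abs_arg_laplace_le b hz
  have h2 := hb.rho_lt_two
  rw [← Complex.norm_mul_sin_arg, abs_mul, abs_norm, mul_comm]
  gcongr
  rw [Real.abs_sin_eq_sin_abs_of_abs_le_pi (Complex.abs_arg_le_pi _)]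
  refine Real.sin_le_sin_of_le_of_le_pi_div_two ?_ ?_ h1
  · linarith [abs_nonneg (Complex.arg (laplace b z))]
  · nlinarith

/-- The power `b̂ ^ (1 / (ρ - 1))`, written with the principal logarithm. It maps the right half
plane to its closure. -/
noncomputable def laplaceRoot (b : ℝ → ℝ) (z : ℂ) : ℂ :=
  Complex.exp ((((rho b - 1)⁻¹ : ℝ) : ℂ) * Complex.log (laplace b z))

theorem KernelAssumption.laplaceRoot_re_nonneg (hb : KernelAssumption b) {z : ℂ}
    (hz : 0 < z.re) : 0 ≤ (laplaceRoot b z).re := by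
  have hα : 0 < rho b - 1 := by linarith [hb.one_lt_rho]
  rw [laplaceRoot, Complex.exp_re, Complex.im_ofReal_mul, Complex.log_im]
  refine mul_nonneg (Real.exp_pos _).le ?_
  have h1 := abs_arg_laplace_le b hz
  have h2 : |(rho b - 1)⁻¹ * Complex.arg (laplace b z)| ≤ Real.pi / 2 := by
    rw [abs_mul, abs_of_pos (inv_pos.2 hα), inv_mul_le_iff₀ hα]
    exact h1
  exact Real.cos_nonneg_of_mem_Icc (abs_le.1 h2)

theorem KernelAssumption.differentiableAt_laplaceRoot (hb : KernelAssumption b) {z : ℂ}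
    (hz : 0 < z.re) : DifferentiableAt ℂ (laplaceRoot b) z :=
  (((hb.differentiableAt_laplace hz).clog (Or.inl (hb.laplace_re_pos hz))).const_mul _).cexp

theorem KernelAssumption.laplaceRoot_ofReal (hb : KernelAssumption b) {x : ℝ} (hx : 0 < x) :
    laplaceRoot b x =
      ((Real.exp ((rho b - 1)⁻¹ * Real.log (laplace b x).re) : ℝ) : ℂ) := by
  have hpos := hb.laplace_re_pos (z := x) (by simpa using hx)
  have hreal : laplace b x = (((laplace b x).re : ℝ) : ℂ) := by
    rw [hb.laplace_ofReal hx, Complex.ofReal_re]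
  rw [laplaceRoot, hreal, ← Complex.ofReal_log (by simpa using hpos.le)]
  simp

theorem norm_sub_div_add_le_one {F : ℂ} {B : ℝ} (hF : 0 ≤ F.re) (hB : 0 < B) :
    ‖(F - B) / (F + B)‖ ≤ 1 := by
  rw [norm_div]
  refine div_le_one_of_le₀ ?_ (norm_nonneg _)
  rw [← sq_le_sq₀ (norm_nonneg _) (norm_nonneg _), Complex.sq_norm, Complex.sq_norm,
    Complex.normSq_apply, Complex.normSq_apply]
  simp only [Complex.sub_re, Complex.ofReal_re, Complex.sub_im, Complex.ofReal_im, sub_zero,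
    Complex.add_re, Complex.add_im, add_zero]
  nlinarith [mul_nonneg hF hB.le]

theorem cayley_re_pos {ζ : ℂ} (hζ : ‖ζ‖ < 1) : 0 < ((1 + ζ) / (1 - ζ)).re := by
  have h1 : (1 : ℂ) - ζ ≠ 0 := by
    intro h
    rw [sub_eq_zero] at h
    rw [← h] at hζ
    simp at hζ
  have h2 : 0 < Complex.normSq (1 - ζ) := Complex.normSq_pos.2 h1
  have h3 : ζ.re * ζ.re + ζ.im * ζ.im < 1 := by
    rw [← Complex.normSq_apply, ← Complex.sq_norm]
    nlinarith [norm_nonneg ζ]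
  have h4 : ((1 + ζ) / (1 - ζ)).re =
      (1 - (ζ.re * ζ.re + ζ.im * ζ.im)) / Complex.normSq (1 - ζ) := by
    rw [Complex.div_re]
    simp
    ring
  rw [h4]
  exact div_pos (by linarith) h2

/-- The Schwarz lemma for `laplaceRoot`, transported to the unit disc at the source and at the
target by Cayley transforms. -/
theorem KernelAssumption.laplaceRoot_one_le (hb : KernelAssumption b) {x : ℝ} (hx : 1 ≤ x) :
    (laplaceRoot b 1).re ≤ x * (laplaceRoot b x).re := by
  have hx0 : 0 < x := by linarith
  obtain ⟨B, hB⟩ : ∃ B : ℝ, B = (laplaceRoot b ((1 : ℝ) : ℂ)).re := ⟨_, rfl⟩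
  obtain ⟨Y, hY⟩ : ∃ Y : ℝ, Y = (laplaceRoot b (x : ℂ)).re := ⟨_, rfl⟩
  have hB0 : 0 < B := by
    rw [hB, hb.laplaceRoot_ofReal one_pos, Complex.ofReal_re]; exact Real.exp_pos _
  have hY0 : 0 < Y := by
    rw [hY, hb.laplaceRoot_ofReal hx0, Complex.ofReal_re]; exact Real.exp_pos _
  have hBc : laplaceRoot b 1 = (B : ℂ) := by
    have := hb.laplaceRoot_ofReal one_pos
    rw [hB, this, Complex.ofReal_re, ← this, Complex.ofReal_one]
  have hYc : laplaceRoot b x = (Y : ℂ) := by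
    rw [hY, hb.laplaceRoot_ofReal hx0, Complex.ofReal_re]
  set f : ℂ → ℂ := fun ζ => (laplaceRoot b ((1 + ζ) / (1 - ζ)) - B) /
    (laplaceRoot b ((1 + ζ) / (1 - ζ)) + B) with hf
  have hd : DifferentiableOn ℂ f (Metric.ball 0 1) := by
    intro ζ hζ
    have hζ1 : ‖ζ‖ < 1 := by simpa using hζ
    have hne : (1 : ℂ) - ζ ≠ 0 := by
      intro h
      rw [sub_eq_zero] at h
      rw [← h] at hζ1
      simp at hζ1
    have hc := cayley_re_pos hζ1
    have hG : DifferentiableAt ℂ (fun ζ => laplaceRoot b ((1 + ζ) / (1 - ζ))) ζ := by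
      refine DifferentiableAt.comp (f := fun ζ : ℂ => (1 + ζ) / (1 - ζ)) ζ
        (hb.differentiableAt_laplaceRoot hc) ?_
      exact ((differentiableAt_const _).add differentiableAt_id).div
        ((differentiableAt_const _).sub differentiableAt_id) hne
    refine ((hG.sub_const _).div (hG.add_const _) fun h => ?_).differentiableWithinAt
    have h1 := congrArg Complex.re h
    have h2 := hb.laplaceRoot_re_nonneg hc
    simp at h1
    linarith
  have hmaps : MapsTo f (Metric.ball 0 1) (Metric.closedBall 0 1) := by
    intro ζ hζ
    have hζ1 : ‖ζ‖ < 1 := by simpa using hζ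
    simpa [hf] using norm_sub_div_add_le_one (hb.laplaceRoot_re_nonneg (cayley_re_pos hζ1)) hB0
  have h0 : f 0 = 0 := by simp [hf, hBc]
  set ζ : ℂ := (((x - 1) / (x + 1) : ℝ) : ℂ) with hζ
  have hζn : ‖ζ‖ = (x - 1) / (x + 1) := by
    rw [hζ, Complex.norm_real, Real.norm_eq_abs,
      abs_of_nonneg (div_nonneg (by linarith) (by linarith))]
  have hζ1 : ‖ζ‖ < 1 := by rw [hζn, div_lt_one (by linarith)]; linarith
  have hs := Complex.norm_le_norm_of_mapsTo_ball hd hmaps h0 hζ1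
  have hm : (1 + ζ) / (1 - ζ) = (x : ℂ) := by
    have h1 : ((1 + (x - 1) / (x + 1)) / (1 - (x - 1) / (x + 1)) : ℝ) = x := by
      have : x + 1 ≠ 0 := by positivity
      field_simp
      ring
    have h2 := congrArg (fun r : ℝ => (r : ℂ)) h1
    push_cast at h2
    rw [hζ]
    push_cast
    exact h2
  have hfζ : f ζ = (((Y - B) / (Y + B) : ℝ) : ℂ) := by
    simp only [hf, hm, hYc]; push_cast; ring
  rw [hfζ, hζn, Complex.norm_real, Real.norm_eq_abs] at hs
  have h1 := (neg_le_abs _).trans hs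
  rw [← neg_div, div_le_div_iff₀ (by linarith) (by linarith)] at h1
  rw [hBc, hYc, Complex.ofReal_re, Complex.ofReal_re]
  nlinarith

/-- Since `x ↦ x b̂(x) ^ (1 / (ρ - 1))` stays above its value at `1` for `x ≥ 1`, the transform
decays on the positive axis no faster than `x ^ (1 - ρ)`. -/
theorem KernelAssumption.laplace_re_ge_rpow (hb : KernelAssumption b) {x : ℝ} (hx : 1 ≤ x) :
    (laplace b 1).re * x ^ (-(rho b - 1)) ≤ (laplace b x).re := by
  have hx0 : 0 < x := by linarith
  have hα : 0 < rho b - 1 := by linarith [hb.one_lt_rho]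
  have h := hb.laplaceRoot_one_le hx
  have h1 := hb.laplaceRoot_ofReal one_pos
  rw [Complex.ofReal_one] at h1
  rw [h1, hb.laplaceRoot_ofReal hx0, Complex.ofReal_re, Complex.ofReal_re] at h
  have p1 : 0 < (laplace b 1).re := hb.laplace_re_pos (by simp)
  have px : 0 < (laplace b x).re := hb.laplace_re_pos (by simpa using hx0)
  have h2 := Real.log_le_log (Real.exp_pos _) h
  rw [Real.log_exp, Real.log_mul hx0.ne' (Real.exp_pos _).ne', Real.log_exp] at h2
  rw [← Real.log_le_log_iff (by positivity) px, Real.log_mul p1.ne' (by positivity),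
    Real.log_rpow hx0]
  have h3 := mul_le_mul_of_nonneg_left h2 hα.le
  rw [mul_add, mul_inv_cancel_left₀ hα.ne', mul_inv_cancel_left₀ hα.ne'] at h3
  linarith

/-- A lower bound `|b̂(z)| ≥ c min(1, |z|^{1-ρ})` on the right half plane. -/
theorem KernelAssumption.exists_le_norm_laplace (hb : KernelAssumption b) :
    ∃ c : ℝ, 0 < c ∧ ∀ z : ℂ, 0 < z.re → (‖z‖ ≤ 1 → c ≤ ‖laplace b z‖) ∧
      (1 ≤ ‖z‖ → c * ‖z‖ ^ (-(rho b - 1)) ≤ ‖laplace b z‖) := by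
  have hcos : 0 < Real.cos 1 := Real.cos_one_pos
  have p1 : 0 < (laplace b 1).re := hb.laplace_re_pos (by simp)
  have pJ := hb.integral_Ioc_pos one_pos
  set d := Real.cos 1 * Real.exp (-1) / 9 with hd
  have hd0 : 0 < d := by positivity
  refine ⟨d * min (∫ t in Ioc 0 1, b t) ((laplace b 1).re / 2), by positivity,
    fun z hz => ?_⟩
  have hz0 : 0 < ‖z‖ := hz.trans_le ((le_abs_self _).trans (Complex.abs_re_le_norm z))
  have h := hb.le_norm_laplace hz
  rw [← hd] at h
  refine ⟨fun h1 => le_trans ?_ h, fun h1 => le_trans ?_ h⟩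
  · refine mul_le_mul_of_nonneg_left ((min_le_left _ _).trans ?_) hd0.le
    refine setIntegral_mono_set (hb.integrableOn_Ioc _) ?_
      (Ioc_subset_Ioc_right ((one_le_inv₀ hz0).2 h1)).eventuallyLE
    exact (ae_restrict_iff' measurableSet_Ioc).2
      (ae_of_all _ fun t ht => hb.threeMonotone.nonneg t ht.1)
  · rw [mul_assoc]
    refine mul_le_mul_of_nonneg_left ?_ hd0.le
    have h2 := hb.laplace_re_ge_rpow h1
    have h3 := hb.laplace_le hz0
    have h4 : 0 < ‖z‖ ^ (-(rho b - 1)) := by positivity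
    have h5 := mul_le_mul_of_nonneg_right
      (min_le_right (∫ t in Ioc 0 1, b t) ((laplace b 1).re / 2)) h4.le
    linarith

/-- Two complex numbers whose arguments differ by at most an angle less than `π` cannot cancel. -/
theorem norm_add_sq_ge_of_sector {w β : ℂ} {κ : ℝ} (hw : 0 ≤ w.re) (hβ : 0 ≤ β.re)
    (hκ : |β.im| ≤ κ * ‖β‖) (hκ0 : 0 ≤ κ) :
    (1 - κ) * (‖w‖ ^ 2 + ‖β‖ ^ 2) ≤ ‖w + β‖ ^ 2 := by
  have h1 : ‖w + β‖ ^ 2 = ‖w‖ ^ 2 + ‖β‖ ^ 2 + 2 * (w.re * β.re + w.im * β.im) := by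
    simp only [Complex.sq_norm, Complex.normSq_apply, Complex.add_re, Complex.add_im]; ring
  have h2 : -(‖w‖ * (κ * ‖β‖)) ≤ w.im * β.im := by
    have := mul_le_mul (Complex.abs_im_le_norm w) hκ (abs_nonneg _) (norm_nonneg _)
    rw [← abs_mul] at this
    linarith [neg_abs_le (w.im * β.im)]
  nlinarith [mul_nonneg hw hβ, mul_nonneg hκ0 (sq_nonneg (‖w‖ - ‖β‖))]

/-- The coercivity estimate for the symbol `w + l b̂(w)`, uniform in `l ≥ l₀`. If `|w| < l ^ (1/ρ)`,
the lower bound for `b̂` shows that `l |b̂(w)|` is at least a multiple of `l ^ (1/ρ)`. -/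
theorem KernelAssumption.exists_symbol_ge (hb : KernelAssumption b) {l₀ : ℝ} (hl₀ : 0 < l₀) :
    ∃ c : ℝ, 0 < c ∧ ∀ l : ℝ, l₀ ≤ l → ∀ w : ℂ, 0 < w.re →
      c * ((l ^ (1 / rho b)) ^ 2 + ‖w‖ ^ 2) ≤ ‖w + l * laplace b w‖ ^ 2 := by
  have hpi := Real.pi_pos
  obtain ⟨c, hc, hlow⟩ := hb.exists_le_norm_laplace
  have hα : 0 < rho b - 1 := by linarith [hb.one_lt_rho]
  have hρ : 0 < rho b := by linarith
  have hρ2 := hb.rho_lt_two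
  set κ := Real.sin ((rho b - 1) * (Real.pi / 2)) with hκ
  have hκ0 : 0 ≤ κ := Real.sin_nonneg_of_nonneg_of_le_pi (by positivity) (by nlinarith)
  have hκ1 : κ < 1 := by
    have h := Real.sin_lt_sin_of_lt_of_le_pi_div_two (x := (rho b - 1) * (Real.pi / 2))
      (by nlinarith) le_rfl (by nlinarith)
    rwa [Real.sin_pi_div_two] at h
  set m := min 1 ((l₀ ^ (1 / rho b)) ^ (rho b - 1)) with hm
  have hm0 : 0 < m := by positivity
  refine ⟨(1 - κ) * min (1 / 2) ((c * m) ^ 2),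
    mul_pos (by linarith) (by positivity), fun l hl w hw => ?_⟩
  have hl0 : 0 < l := hl₀.trans_le hl
  set L := l ^ (1 / rho b) with hL
  have hL0 : 0 < L := by positivity
  have hLl : L ^ rho b = l := by
    rw [hL, ← Real.rpow_mul hl0.le, one_div_mul_cancel hρ.ne', Real.rpow_one]
  have hre := hb.laplace_re_pos hw
  have him := hb.abs_laplace_im_le hw
  have hsec := norm_add_sq_ge_of_sector (w := w) (β := l * laplace b w) (κ := κ) hw.le
    (by simpa using (mul_pos hl0 hre).le)
    (by
      rw [Complex.im_ofReal_mul, norm_mul, abs_mul, Complex.norm_real, Real.norm_eq_abs]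
      have := mul_le_mul_of_nonneg_left him (abs_nonneg l)
      linarith) hκ0
  refine le_trans ?_ hsec
  rw [mul_assoc]
  refine mul_le_mul_of_nonneg_left ?_ (by linarith)
  have hmin1 := min_le_left (1 / 2 : ℝ) ((c * m) ^ 2)
  have hmin2 := min_le_right (1 / 2 : ℝ) ((c * m) ^ 2)
  rcases le_or_gt L ‖w‖ with hLw | hLw
  · nlinarith [sq_nonneg L, sq_nonneg ‖w‖, pow_le_pow_left₀ hL0.le hLw 2,
      sq_nonneg ‖(l : ℂ) * laplace b w‖]
  · have hkey : c * m * L ≤ ‖(l : ℂ) * laplace b w‖ := by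
      rw [norm_mul, Complex.norm_real, Real.norm_eq_abs, abs_of_pos hl0]
      have hsplit : l = L * L ^ (rho b - 1) := by
        have h := Real.rpow_add hL0 1 (rho b - 1)
        rwa [add_sub_cancel, Real.rpow_one, hLl] at h
      have hp : 0 < L ^ (rho b - 1) := by positivity
      rcases le_or_gt ‖w‖ 1 with h1 | h1
      · have h2 := (hlow w hw).1 h1
        have h3 : m ≤ L ^ (rho b - 1) := (min_le_right _ _).trans
          (by gcongr; exact Real.rpow_le_rpow hl₀.le hl (by positivity))
        calc c * m * L ≤ c * L ^ (rho b - 1) * L := by gcongr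
          _ = l * c := by rw [hsplit]; ring
          _ ≤ _ := by gcongr
      · have hw0 : 0 < ‖w‖ := by linarith
        have h2 := (hlow w hw).2 h1.le
        have h3 : L ^ (-(rho b - 1)) ≤ ‖w‖ ^ (-(rho b - 1)) :=
          Real.rpow_le_rpow_of_nonpos hw0 hLw.le (by linarith)
        have h4 : L ^ (rho b - 1) * L ^ (-(rho b - 1)) = 1 := by
          rw [← Real.rpow_add hL0]; simp
        calc c * m * L ≤ c * 1 * L := by gcongr; exact min_le_left _ _
          _ = l * (c * L ^ (-(rho b - 1))) := by
            calc c * 1 * L = c * L * (L ^ (rho b - 1) * L ^ (-(rho b - 1))) := by rw [h4]; ring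
              _ = (L * L ^ (rho b - 1)) * (c * L ^ (-(rho b - 1))) := by ring
              _ = _ := by rw [← hsplit]
          _ ≤ l * (c * ‖w‖ ^ (-(rho b - 1))) := by gcongr
          _ ≤ _ := by gcongr
    have h5 : (c * m * L) ^ 2 ≤ ‖(l : ℂ) * laplace b w‖ ^ 2 := by gcongr
    nlinarith [sq_nonneg L, sq_nonneg ‖w‖]

/-! ### Power series on circles -/

/-- The point `r exp(iθ)`. -/
noncomputable def circlePoint (r θ : ℝ) : ℂ := (r : ℂ) * Complex.exp (θ * Complex.I)

theorem continuous_circlePoint (r : ℝ) : Continuous (circlePoint r) := by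
  unfold circlePoint; fun_prop

theorem norm_circlePoint {r : ℝ} (hr : 0 ≤ r) (θ : ℝ) : ‖circlePoint r θ‖ = r := by
  rw [circlePoint, norm_mul, Complex.norm_exp_ofReal_mul_I, Complex.norm_real, Real.norm_eq_abs,
    abs_of_nonneg hr, mul_one]

theorem integral_circlePoint_pow_mul_conj (r : ℝ) (n m : ℕ) :
    ∫ θ in -Real.pi..Real.pi, circlePoint r θ ^ n * (starRingEnd ℂ) (circlePoint r θ ^ m) =
      if n = m then 2 * Real.pi * (r : ℂ) ^ (2 * n) else 0 := by
  have h : ∀ θ : ℝ, circlePoint r θ ^ n * (starRingEnd ℂ) (circlePoint r θ ^ m) =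
      (r : ℂ) ^ (n + m) * Complex.exp ((((n : ℂ) - m) * Complex.I) * θ) := by
    intro θ
    simp only [circlePoint, map_pow, map_mul, Complex.conj_ofReal, ← Complex.exp_conj,
      Complex.conj_I, mul_pow, ← Complex.exp_nat_mul, map_natCast]
    rw [mul_mul_mul_comm, ← pow_add, ← Complex.exp_add]
    ring_nf
  simp_rw [h]
  rw [intervalIntegral.integral_const_mul]
  split_ifs with hnm
  · subst hnm
    simp
    ring
  · have hc : ((n : ℂ) - m) * Complex.I ≠ 0 :=
      mul_ne_zero (sub_ne_zero.2 (by exact_mod_cast hnm)) Complex.I_ne_zero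
    rw [integral_exp_mul_complex hc]
    have he : Complex.exp (((n : ℂ) - m) * Complex.I * (Real.pi : ℝ)) =
        Complex.exp (((n : ℂ) - m) * Complex.I * ((-Real.pi : ℝ) : ℂ)) := by
      rw [Complex.exp_eq_exp_iff_exists_int]
      exact ⟨(n : ℤ) - m, by push_cast; ring⟩
    rw [he]
    simp

theorem norm_mul_circlePoint_pow {r : ℝ} (hr : 0 ≤ r) (c : ℂ) (n : ℕ) (θ : ℝ) :
    ‖c * circlePoint r θ ^ n‖ = ‖c‖ * r ^ n := by
  rw [norm_mul, norm_pow, norm_circlePoint hr]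

theorem continuous_tsum_circlePoint {c : ℕ → ℂ} {r : ℝ} (hr : 0 ≤ r)
    (hc : Summable fun n => ‖c n‖ * r ^ n) :
    Continuous fun θ => ∑' n, c n * circlePoint r θ ^ n :=
  continuous_tsum (fun n => continuous_const.mul ((continuous_circlePoint r).pow n)) hc
    fun n θ => (norm_mul_circlePoint_pow hr _ n θ).le

theorem integral_tsum_mul_conj_pow {c : ℕ → ℂ} {r : ℝ} (hr : 0 ≤ r)
    (hc : Summable fun n => ‖c n‖ * r ^ n) (m : ℕ) :
    ∫ θ in -Real.pi..Real.pi, (∑' n, c n * circlePoint r θ ^ n) *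
      (starRingEnd ℂ) (circlePoint r θ ^ m) = 2 * Real.pi * c m * (r : ℂ) ^ (2 * m) := by
  have hs := intervalIntegral.hasSum_integral_of_dominated_convergence
    (a := -Real.pi) (b := Real.pi) (μ := volume)
    (F := fun n θ => c n * circlePoint r θ ^ n * (starRingEnd ℂ) (circlePoint r θ ^ m))
    (f := fun θ => (∑' n, c n * circlePoint r θ ^ n) * (starRingEnd ℂ) (circlePoint r θ ^ m))
    (fun n _ => ‖c n‖ * r ^ n * r ^ m)
    (fun n => by
      have := continuous_circlePoint r
      refine Continuous.aestronglyMeasurable ?_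
      exact (continuous_const.mul (this.pow n)).mul (Complex.continuous_conj.comp (this.pow m)))
    (fun n => ae_of_all _ fun θ _ => by
      rw [norm_mul, norm_mul_circlePoint_pow hr, RCLike.norm_conj, norm_pow, norm_circlePoint hr])
    (ae_of_all _ fun θ _ => hc.mul_right _)
    (by simp)
    (ae_of_all _ fun θ _ => by
      refine HasSum.mul_right _ (Summable.hasSum (Summable.of_norm ?_))
      simpa [norm_mul_circlePoint_pow hr, norm_circlePoint hr] using hc)
  have h1 : ∀ n, ∫ θ in -Real.pi..Real.pi,
      c n * circlePoint r θ ^ n * (starRingEnd ℂ) (circlePoint r θ ^ m) =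
      if n = m then 2 * Real.pi * c m * (r : ℂ) ^ (2 * m) else 0 := by
    intro n
    simp_rw [mul_assoc]
    rw [intervalIntegral.integral_const_mul, integral_circlePoint_pow_mul_conj]
    split_ifs with h
    · subst h; ring
    · simp
  simp_rw [h1] at hs
  exact hs.unique (hasSum_ite_eq m _)

theorem integral_tsum_mul_conj_sum {c : ℕ → ℂ} {r : ℝ} (hr : 0 ≤ r)
    (hc : Summable fun n => ‖c n‖ * r ^ n) (d : ℕ → ℂ) (N : ℕ) :
    ∫ θ in -Real.pi..Real.pi, (∑' n, c n * circlePoint r θ ^ n) *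
      (starRingEnd ℂ) (∑ n ∈ Finset.range N, d n * circlePoint r θ ^ n) =
      2 * Real.pi * ∑ n ∈ Finset.range N, c n * (starRingEnd ℂ) (d n) * (r : ℂ) ^ (2 * n) := by
  have hcont := continuous_tsum_circlePoint hr hc
  have hp := continuous_circlePoint r
  have h : ∀ θ : ℝ, (∑' n, c n * circlePoint r θ ^ n) *
      (starRingEnd ℂ) (∑ n ∈ Finset.range N, d n * circlePoint r θ ^ n) =
      ∑ m ∈ Finset.range N, (starRingEnd ℂ) (d m) * ((∑' n, c n * circlePoint r θ ^ n) *
        (starRingEnd ℂ) (circlePoint r θ ^ m)) := by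
    intro θ
    rw [map_sum, Finset.mul_sum]
    refine Finset.sum_congr rfl fun m _ => ?_
    rw [map_mul]; ring
  simp_rw [h]
  rw [intervalIntegral.integral_finsetSum, Finset.mul_sum]
  · refine Finset.sum_congr rfl fun m _ => ?_
    rw [intervalIntegral.integral_const_mul, integral_tsum_mul_conj_pow hr hc]
    ring
  · intro m _
    refine Continuous.intervalIntegrable ?_ _ _
    exact continuous_const.mul (hcont.mul (Complex.continuous_conj.comp (hp.pow m)))

/-- Bessel's inequality for a power series on the circle of radius `r`. -/
theorem sum_norm_sq_le_integral {c : ℕ → ℂ} {r : ℝ} (hr : 0 ≤ r)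
    (hc : Summable fun n => ‖c n‖ * r ^ n) (N : ℕ) :
    2 * Real.pi * ∑ n ∈ Finset.range N, ‖c n‖ ^ 2 * r ^ (2 * n) ≤
      ∫ θ in -Real.pi..Real.pi, ‖∑' n, c n * circlePoint r θ ^ n‖ ^ 2 := by
  have hcont := continuous_tsum_circlePoint hr hc
  have hp := continuous_circlePoint r
  have hpoly : Continuous fun θ => ∑ n ∈ Finset.range N, c n * circlePoint r θ ^ n :=
    continuous_finsetSum _ fun n _ => continuous_const.mul (hp.pow n)
  set S := ∑ n ∈ Finset.range N, ‖c n‖ ^ 2 * r ^ (2 * n) with hS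
  have hSc : ∑ n ∈ Finset.range N, c n * (starRingEnd ℂ) (c n) * (r : ℂ) ^ (2 * n) = (S : ℂ) := by
    rw [hS]
    push_cast
    refine Finset.sum_congr rfl fun n _ => ?_
    rw [Complex.mul_conj']
  -- the truncated series is the orthogonal projection of the series
  set c' : ℕ → ℂ := fun n => if n < N then c n else 0 with hc'
  have htr : ∀ θ, ∑' n, c' n * circlePoint r θ ^ n =
      ∑ n ∈ Finset.range N, c n * circlePoint r θ ^ n := by
    intro θ
    rw [tsum_eq_sum (s := Finset.range N) (fun n hn => by
      rw [Finset.mem_range] at hn; simp [hc', hn])]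
    refine Finset.sum_congr rfl fun n hn => ?_
    simp [hc', Finset.mem_range.1 hn]
  have hc's : Summable fun n => ‖c' n‖ * r ^ n :=
    summable_of_ne_finset_zero (s := Finset.range N) fun n hn => by
      rw [Finset.mem_range] at hn; simp [hc', hn]
  have hA := integral_tsum_mul_conj_sum hr hc c N
  have hB := integral_tsum_mul_conj_sum hr hc's c N
  simp_rw [htr] at hB
  have hB' : ∑ n ∈ Finset.range N, c' n * (starRingEnd ℂ) (c n) * (r : ℂ) ^ (2 * n) = (S : ℂ) := by
    rw [← hSc]
    refine Finset.sum_congr rfl fun n hn => ?_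
    simp [hc', Finset.mem_range.1 hn]
  rw [hSc] at hA
  rw [hB'] at hB
  set f : ℝ → ℂ := fun θ => ∑' n, c n * circlePoint r θ ^ n with hf
  set p : ℝ → ℂ := fun θ => ∑ n ∈ Finset.range N, c n * circlePoint r θ ^ n with hp'
  have hfp : Continuous fun θ => f θ * (starRingEnd ℂ) (p θ) :=
    hcont.mul (Complex.continuous_conj.comp hpoly)
  have hpp : Continuous fun θ => p θ * (starRingEnd ℂ) (p θ) :=
    hpoly.mul (Complex.continuous_conj.comp hpoly)
  have hA' : ∫ θ in -Real.pi..Real.pi, (f θ * (starRingEnd ℂ) (p θ)).re = 2 * Real.pi * S := by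
    have h1 := Complex.reCLM.intervalIntegral_comp_comm
      (hfp.intervalIntegrable (μ := volume) (-Real.pi) Real.pi)
    simp only [Complex.reCLM_apply] at h1
    rw [h1, hA]
    norm_cast
  have hB'' : ∫ θ in -Real.pi..Real.pi, (p θ * (starRingEnd ℂ) (p θ)).re = 2 * Real.pi * S := by
    have h1 := Complex.reCLM.intervalIntegral_comp_comm
      (hpp.intervalIntegrable (μ := volume) (-Real.pi) Real.pi)
    simp only [Complex.reCLM_apply] at h1
    rw [h1, hB]
    norm_cast
  have hre1 : Continuous fun θ => (f θ * (starRingEnd ℂ) (p θ)).re :=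
    Complex.continuous_re.comp hfp
  have hre2 : Continuous fun θ => (p θ * (starRingEnd ℂ) (p θ)).re :=
    Complex.continuous_re.comp hpp
  have hle : ∫ θ in -Real.pi..Real.pi, (2 * (f θ * (starRingEnd ℂ) (p θ)).re -
      (p θ * (starRingEnd ℂ) (p θ)).re) ≤ ∫ θ in -Real.pi..Real.pi, ‖f θ‖ ^ 2 := by
    refine intervalIntegral.integral_mono_on (by linarith [Real.pi_pos]) ?_ ?_ fun θ _ => ?_
    · exact ((continuous_const.mul hre1).sub hre2).intervalIntegrable _ _
    · exact (hcont.norm.pow 2).intervalIntegrable _ _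
    · simp only [Complex.sq_norm, Complex.normSq_apply, Complex.mul_re, Complex.conj_re,
        Complex.conj_im]
      nlinarith [sq_nonneg ((f θ).re - (p θ).re), sq_nonneg ((f θ).im - (p θ).im)]
  rw [intervalIntegral.integral_sub
    ((hre1.const_mul 2).intervalIntegrable _ _) (hre2.intervalIntegrable _ _),
    intervalIntegral.integral_const_mul, hA', hB''] at hle
  linarith

/-! ### The quadrature weights -/

theorem one_sub_div_re_pos {dt : ℝ} (hdt : 0 < dt) {z : ℂ} (hz : ‖z‖ < 1) :
    0 < ((1 - z) / (dt : ℂ)).re := by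
  rw [Complex.div_ofReal_re]
  refine div_pos ?_ hdt
  have := Complex.re_le_norm z
  simp
  linarith

theorem conj_iteratedDeriv_of_conj {f : ℂ → ℂ}
    (hf : ∀ z, f ((starRingEnd ℂ) z) = (starRingEnd ℂ) (f z)) (n : ℕ) (z : ℂ) :
    iteratedDeriv n f ((starRingEnd ℂ) z) = (starRingEnd ℂ) (iteratedDeriv n f z) := by
  induction n generalizing z with
  | zero => simpa using hf z
  | succ n ih =>
    set g := iteratedDeriv n f with hg
    have hgc : g = (starRingEnd ℂ) ∘ g ∘ (starRingEnd ℂ) := by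
      funext w
      simp [ih w]
    rw [iteratedDeriv_succ, ← hg]
    nth_rewrite 1 [hgc]
    rw [deriv_conj_conj]
    simp

theorem ofReal_weight (b : ℝ → ℝ) (dt : ℝ) (k : ℕ) :
    (weight b dt k : ℂ) =
      iteratedDeriv k (fun z : ℂ => laplace b ((1 - z) / (dt : ℂ))) 0 / (k.factorial : ℂ) := by
  unfold weight
  rw [← Complex.conj_eq_iff_re, map_div₀, map_natCast, ← conj_iteratedDeriv_of_conj, map_zero]
  intro z
  rw [← laplace_conj]
  simp

theorem KernelAssumption.hasSum_weight (hb : KernelAssumption b) {dt : ℝ} (hdt : 0 < dt) {z : ℂ}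
    (hz : ‖z‖ < 1) :
    HasSum (fun n => (weight b dt n : ℂ) * z ^ n) (laplace b ((1 - z) / (dt : ℂ))) := by
  have hd : DifferentiableOn ℂ (fun z : ℂ => laplace b ((1 - z) / (dt : ℂ)))
      (Metric.ball 0 1) := by
    intro w hw
    have hw1 : ‖w‖ < 1 := by simpa using hw
    refine DifferentiableAt.differentiableWithinAt ?_
    refine DifferentiableAt.comp (f := fun z : ℂ => (1 - z) / (dt : ℂ)) w
      (hb.differentiableAt_laplace (one_sub_div_re_pos hdt hw1)) (by fun_prop)
  have h := Complex.hasSum_taylorSeries_on_ball hd (z := z) (by simpa using hz)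
  refine h.congr_fun fun n => ?_
  rw [ofReal_weight, smul_eq_mul, smul_eq_mul, sub_zero]
  ring

theorem KernelAssumption.summable_weight (hb : KernelAssumption b) {dt : ℝ} (hdt : 0 < dt) {r : ℝ}
    (hr : 0 ≤ r) (hr1 : r < 1) : Summable fun n => ‖(weight b dt n : ℂ)‖ * r ^ n := by
  have h := (hb.hasSum_weight hdt (z := (r : ℂ))
    (by rwa [Complex.norm_real, Real.norm_eq_abs, abs_of_nonneg hr])).summable.norm
  refine h.congr fun n => ?_
  rw [norm_mul, norm_pow, Complex.norm_real r, Real.norm_eq_abs, abs_of_nonneg hr]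

theorem KernelAssumption.weight_zero_pos (hb : KernelAssumption b) {dt : ℝ} (hdt : 0 < dt) :
    0 < weight b dt 0 := by
  have h := hb.laplace_re_pos (one_sub_div_re_pos hdt (z := 0) (by simp))
  simpa [weight] using h

theorem tsum_pow_mul_tsum_pow {a c : ℕ → ℂ} {z : ℂ} (ha : Summable fun n => ‖a n‖ * ‖z‖ ^ n)
    (hc : Summable fun n => ‖c n‖ * ‖z‖ ^ n) :
    (∑' n, a n * z ^ n) * (∑' n, c n * z ^ n) =
      ∑' n, (∑ k ∈ Finset.range (n + 1), a (n - k) * c k) * z ^ n ∧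
    Summable fun n => ‖∑ k ∈ Finset.range (n + 1), a (n - k) * c k‖ * ‖z‖ ^ n := by
  have ha' : Summable fun n => ‖a n * z ^ n‖ := by simpa [norm_mul, norm_pow] using ha
  have hc' : Summable fun n => ‖c n * z ^ n‖ := by simpa [norm_mul, norm_pow] using hc
  have key : ∀ n, ∑ k ∈ Finset.range (n + 1), c k * z ^ k * (a (n - k) * z ^ (n - k)) =
      (∑ k ∈ Finset.range (n + 1), a (n - k) * c k) * z ^ n := by
    intro n
    rw [Finset.sum_mul]
    refine Finset.sum_congr rfl fun k hk => ?_
    have hkn : k + (n - k) = n := by have := Finset.mem_range.1 hk; omega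
    calc c k * z ^ k * (a (n - k) * z ^ (n - k)) = a (n - k) * c k * z ^ (k + (n - k)) := by
          rw [pow_add]; ring
      _ = _ := by rw [hkn]
  constructor
  · rw [mul_comm, tsum_mul_tsum_eq_tsum_sum_range_of_summable_norm hc' ha']
    exact tsum_congr key
  · have h := summable_norm_sum_mul_range_of_summable_norm hc' ha'
    simp_rw [key, norm_mul, norm_pow] at h
    exact h

/-- The convolution quadrature inherits positivity from `Re b̂ ≥ 0`. -/
theorem KernelAssumption.quadrature_nonneg (hb : KernelAssumption b) {dt : ℝ} (hdt : 0 < dt)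
    (v : ℕ → ℝ) (N : ℕ) :
    0 ≤ ∑ n ∈ Finset.range N,
      (∑ k ∈ Finset.range (n + 1), weight b dt (n - k) * v k) * v n := by
  -- on a circle of radius `r < 1`, the weighted sum is the mean of `Re b̂ |∑ v_n z^n|²`
  set u : ℕ → ℂ := fun n => if n < N then (v n : ℂ) else 0 with hu
  have hinside : ∀ r : ℝ, 0 ≤ r → r < 1 → 0 ≤ ∑ n ∈ Finset.range N,
      (∑ k ∈ Finset.range (n + 1), weight b dt (n - k) * v k) * v n * r ^ (2 * n) := by
    intro r hr hr1
    have hw := hb.summable_weight hdt hr hr1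
    have hus : Summable fun n => ‖u n‖ * r ^ n :=
      summable_of_ne_finset_zero (s := Finset.range N) fun n hn => by
        rw [Finset.mem_range] at hn; simp [hu, hn]
    have hcp := fun θ => tsum_pow_mul_tsum_pow (z := circlePoint r θ)
      (a := fun n => (weight b dt n : ℂ)) (c := u)
      (by simpa [norm_circlePoint hr] using hw) (by simpa [norm_circlePoint hr] using hus)
    have hcs := (hcp 0).2
    rw [norm_circlePoint hr] at hcs
    have htr : ∀ θ, ∑' n, u n * circlePoint r θ ^ n =
        ∑ n ∈ Finset.range N, u n * circlePoint r θ ^ n := fun θ =>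
      tsum_eq_sum (fun n hn => by rw [Finset.mem_range] at hn; simp [hu, hn])
    have hint := integral_tsum_mul_conj_sum hr hcs u N
    have hval : ∑ n ∈ Finset.range N,
        (∑ k ∈ Finset.range (n + 1), (weight b dt (n - k) : ℂ) * u k) *
          (starRingEnd ℂ) (u n) * (r : ℂ) ^ (2 * n) =
        ((∑ n ∈ Finset.range N,
          (∑ k ∈ Finset.range (n + 1), weight b dt (n - k) * v k) * v n * r ^ (2 * n) : ℝ) : ℂ) := by
      push_cast
      refine Finset.sum_congr rfl fun n hn => ?_
      have hn' := Finset.mem_range.1 hn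
      have h1 : (starRingEnd ℂ) (u n) = v n := by simp [hu, hn']
      rw [h1]
      congr 2
      refine Finset.sum_congr rfl fun k hk => ?_
      have : k < N := by have := Finset.mem_range.1 hk; omega
      simp [hu, this]
    rw [hval] at hint
    have hcont : Continuous fun θ => (∑' n, (∑ k ∈ Finset.range (n + 1),
        (weight b dt (n - k) : ℂ) * u k) * circlePoint r θ ^ n) *
        (starRingEnd ℂ) (∑ n ∈ Finset.range N, u n * circlePoint r θ ^ n) :=
      (continuous_tsum_circlePoint hr hcs).mul (Complex.continuous_conj.comp
        (continuous_finsetSum _ fun n _ => continuous_const.mul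
          ((continuous_circlePoint r).pow n)))
    have hre := Complex.reCLM.intervalIntegral_comp_comm
      (hcont.intervalIntegrable (μ := volume) (-Real.pi) Real.pi)
    simp only [Complex.reCLM_apply] at hre
    have hnn : 0 ≤ ∫ θ in -Real.pi..Real.pi, ((∑' n, (∑ k ∈ Finset.range (n + 1),
        (weight b dt (n - k) : ℂ) * u k) * circlePoint r θ ^ n) *
        (starRingEnd ℂ) (∑ n ∈ Finset.range N, u n * circlePoint r θ ^ n)).re := by
      refine intervalIntegral.integral_nonneg (by linarith [Real.pi_pos]) fun θ _ => ?_
      have hz : ‖circlePoint r θ‖ < 1 := by rwa [norm_circlePoint hr]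
      rw [← (hcp θ).1, htr θ, (hb.hasSum_weight hdt hz).tsum_eq, mul_assoc, Complex.mul_conj,
        Complex.re_mul_ofReal]
      exact mul_nonneg (hb.laplace_re_pos (one_sub_div_re_pos hdt hz)).le (Complex.normSq_nonneg _)
    rw [hre, hint] at hnn
    have h2 : (2 * (Real.pi : ℂ) * ((∑ n ∈ Finset.range N,
        (∑ k ∈ Finset.range (n + 1), weight b dt (n - k) * v k) * v n * r ^ (2 * n) : ℝ) : ℂ)).re =
        2 * Real.pi * ∑ n ∈ Finset.range N,
        (∑ k ∈ Finset.range (n + 1), weight b dt (n - k) * v k) * v n * r ^ (2 * n) := by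
      norm_cast
    rw [h2] at hnn
    exact nonneg_of_mul_nonneg_right hnn (by positivity)
  have hlim : Tendsto (fun r : ℝ => ∑ n ∈ Finset.range N,
      (∑ k ∈ Finset.range (n + 1), weight b dt (n - k) * v k) * v n * r ^ (2 * n))
      (𝓝[<] 1) (𝓝 (∑ n ∈ Finset.range N,
      (∑ k ∈ Finset.range (n + 1), weight b dt (n - k) * v k) * v n)) := by
    have hc : Continuous fun r : ℝ => ∑ n ∈ Finset.range N,
      (∑ k ∈ Finset.range (n + 1), weight b dt (n - k) * v k) * v n * r ^ (2 * n) := by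
      fun_prop
    have := (hc.tendsto 1).mono_left (nhdsWithin_le_nhds (s := Iio 1))
    simpa using this
  refine ge_of_tendsto hlim ?_
  filter_upwards [Ioo_mem_nhdsLT (zero_lt_one' ℝ)] with r hr
  exact hinside r hr.1.le hr.2

/-! ### The scheme for a single eigenvalue -/

/-- Testing the scheme with its own solution: the memory term is nonnegative, so the modulus of the
solution never exceeds its initial value. -/
theorem KernelAssumption.scalar_abs_le (hb : KernelAssumption b) {dt l : ℝ} (hdt : 0 < dt)
    (hl : 0 ≤ l) {s : ℕ → ℝ}
    (hs : ∀ n, s (n + 1) - s n +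
      dt * ∑ k ∈ Finset.range (n + 1), weight b dt (n - k) * (l * s (k + 1)) = 0) (n : ℕ) :
    |s n| ≤ |s 0| := by
  have hq := hb.quadrature_nonneg hdt (fun k => s (k + 1)) n
  have hsum : ∑ k ∈ Finset.range n, (s (k + 1) ^ 2 - s k ^ 2) ≤
      ∑ k ∈ Finset.range n, -(2 * dt * l) *
        ((∑ j ∈ Finset.range (k + 1), weight b dt (k - j) * s (j + 1)) * s (k + 1)) := by
    refine Finset.sum_le_sum fun k _ => ?_
    have h1 : ∑ j ∈ Finset.range (k + 1), weight b dt (k - j) * (l * s (j + 1)) =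
        l * ∑ j ∈ Finset.range (k + 1), weight b dt (k - j) * s (j + 1) := by
      rw [Finset.mul_sum]
      exact Finset.sum_congr rfl fun j _ => by ring
    have h2 := hs k
    rw [h1] at h2
    set T := ∑ j ∈ Finset.range (k + 1), weight b dt (k - j) * s (j + 1)
    have h3 : -(2 * dt * l) * (T * s (k + 1)) = 2 * (s (k + 1) - s k) * s (k + 1) := by
      have : s (k + 1) - s k = -(dt * (l * T)) := by linarith
      rw [this]; ring
    rw [h3]
    nlinarith [sq_nonneg (s (k + 1) - s k)]
  rw [Finset.sum_range_sub (fun k => s k ^ 2), ← Finset.mul_sum] at hsum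
  have : 0 ≤ dt * l := by positivity
  exact sq_le_sq.1 (by nlinarith)

/-- The generating function of the solution is the initial value divided by the symbol. -/
theorem KernelAssumption.generating_function_mul_symbol (hb : KernelAssumption b) {dt l : ℝ}
    (hdt : 0 < dt) (hl : 0 ≤ l) {s : ℕ → ℝ}
    (hs : ∀ n, s (n + 1) - s n +
      dt * ∑ k ∈ Finset.range (n + 1), weight b dt (n - k) * (l * s (k + 1)) = 0)
    {z : ℂ} (hz : ‖z‖ < 1) :
    (Summable fun n => ‖(s (n + 1) : ℂ)‖ * ‖z‖ ^ n) ∧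
    (∑' n, (s (n + 1) : ℂ) * z ^ n) *
      (dt * ((1 - z) / (dt : ℂ) + l * laplace b ((1 - z) / (dt : ℂ)))) = s 0 := by
  have hdtc : (dt : ℂ) ≠ 0 := by exact_mod_cast hdt.ne'
  have hbd := hb.scalar_abs_le hdt hl hs
  have hsm : Summable fun n => ‖(s (n + 1) : ℂ)‖ * ‖z‖ ^ n := by
    refine Summable.of_nonneg_of_le (fun n => by positivity) (fun n => ?_)
      ((summable_geometric_of_lt_one (norm_nonneg z) hz).mul_left |s 0|)
    rw [Complex.norm_real, Real.norm_eq_abs]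
    exact mul_le_mul_of_nonneg_right (hbd _) (by positivity)
  refine ⟨hsm, ?_⟩
  have hsm' : Summable fun n => (s (n + 1) : ℂ) * z ^ n :=
    Summable.of_norm (by simpa [norm_mul, norm_pow] using hsm)
  have hsm0 : Summable fun n => (s n : ℂ) * z ^ n := by
    refine (summable_nat_add_iff 1).1 ?_
    refine (hsm'.mul_left z).congr fun n => ?_
    rw [pow_succ]; ring
  have hw := hb.summable_weight hdt (norm_nonneg z) hz
  obtain ⟨hprod, hprods⟩ := tsum_pow_mul_tsum_pow (z := z)
    (a := fun n => (weight b dt n : ℂ)) (c := fun n => (s (n + 1) : ℂ)) hw hsm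
  rw [(hb.hasSum_weight hdt hz).tsum_eq] at hprod
  have hprods' : Summable fun n => (∑ k ∈ Finset.range (n + 1),
      (weight b dt (n - k) : ℂ) * (s (k + 1) : ℂ)) * z ^ n :=
    Summable.of_norm (by simpa [norm_mul, norm_pow] using hprods)
  have hrec : ∀ n, (s (n + 1) : ℂ) * z ^ n - (s n : ℂ) * z ^ n + dt * l *
      ((∑ k ∈ Finset.range (n + 1), (weight b dt (n - k) : ℂ) * (s (k + 1) : ℂ)) * z ^ n) = 0 := by
    intro n
    have h := congrArg (fun x : ℝ => (x : ℂ)) (hs n)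
    have h1 : ∑ k ∈ Finset.range (n + 1), weight b dt (n - k) * (l * s (k + 1)) =
        l * ∑ k ∈ Finset.range (n + 1), weight b dt (n - k) * s (k + 1) := by
      rw [Finset.mul_sum]
      exact Finset.sum_congr rfl fun j _ => by ring
    rw [h1] at h
    push_cast at h
    linear_combination z ^ n * h
  have hshift : ∑' n, (s n : ℂ) * z ^ n = s 0 + z * ∑' n, (s (n + 1) : ℂ) * z ^ n := by
    rw [hsm0.tsum_eq_zero_add, ← tsum_mul_left]
    simp only [pow_zero, mul_one]
    congr 1
    exact tsum_congr fun n => by rw [pow_succ]; ring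
  have htot := ((hsm'.hasSum.sub hsm0.hasSum).add
    (hprods'.hasSum.mul_left ((dt : ℂ) * l))).congr_fun (fun n => (hrec n).symm)
  have h0 := htot.unique hasSum_zero
  rw [hshift, ← hprod] at h0
  have hcancel : (dt : ℂ) * ((1 - z) / (dt : ℂ)) = 1 - z := mul_div_cancel₀ _ hdtc
  rw [mul_add, hcancel]
  linear_combination h0

theorem norm_one_sub_circlePoint_sq_ge {r θ : ℝ} (hr : 1 / 2 ≤ r) (hθ : |θ| ≤ Real.pi) :
    θ ^ 2 / 9 ≤ ‖1 - circlePoint r θ‖ ^ 2 := by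
  have hcos := Real.cos_le_one_sub_mul_cos_sq hθ
  have h1 : ‖1 - circlePoint r θ‖ ^ 2 = (1 - r) ^ 2 + 2 * r * (1 - Real.cos θ) := by
    rw [Complex.sq_norm, Complex.normSq_apply, circlePoint]
    simp only [Complex.sub_re, Complex.one_re, Complex.re_ofReal_mul, Complex.exp_ofReal_mul_I_re,
      Complex.sub_im, Complex.one_im, Complex.im_ofReal_mul, Complex.exp_ofReal_mul_I_im]
    nlinarith [Real.sin_sq_add_cos_sq θ]
  have h2 : θ ^ 2 / 9 ≤ 2 / Real.pi ^ 2 * θ ^ 2 := by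
    have : (1 : ℝ) / 9 ≤ 2 / Real.pi ^ 2 := by
      rw [div_le_div_iff₀ (by norm_num) (by positivity)]
      nlinarith [Real.pi_le_four, Real.pi_pos]
    nlinarith [sq_nonneg θ]
  rw [h1]
  nlinarith [sq_nonneg (1 - r), Real.cos_le_one θ]

theorem integrable_and_integral_inv_sq_add {D : ℝ} (hD : 0 < D) :
    Integrable (fun θ : ℝ => (D ^ 2 + θ ^ 2 / 9)⁻¹) ∧
      ∫ θ : ℝ, (D ^ 2 + θ ^ 2 / 9)⁻¹ = 3 * Real.pi / D := by
  have h : ∀ θ : ℝ, (D ^ 2 + θ ^ 2 / 9)⁻¹ = (D ^ 2)⁻¹ * (1 + (θ / (3 * D)) ^ 2)⁻¹ := by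
    intro θ
    rw [← mul_inv]
    congr 1
    field_simp
    ring
  simp_rw [h]
  refine ⟨(integrable_inv_one_add_sq.comp_div (by positivity)).const_mul _, ?_⟩
  rw [integral_const_mul, Measure.integral_comp_div (fun x : ℝ => (1 + x ^ 2)⁻¹),
    integral_univ_inv_one_add_sq, abs_of_pos (by positivity), smul_eq_mul]
  field_simp

/-- The square sum of the scalar solution. Bessel's inequality bounds it by the mean square of the
generating function, which the symbol estimate bounds by `∫ (D² + θ²/9)⁻¹` with
`D = Δt l ^ (1/ρ)`. -/
theorem KernelAssumption.exists_scalar_sum_sq_le (hb : KernelAssumption b) {l₀ : ℝ}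
    (hl₀ : 0 < l₀) :
    ∃ C : ℝ, 0 < C ∧ ∀ dt : ℝ, 0 < dt → ∀ l : ℝ, l₀ ≤ l → ∀ s : ℕ → ℝ,
      (∀ n, s (n + 1) - s n +
        dt * ∑ k ∈ Finset.range (n + 1), weight b dt (n - k) * (l * s (k + 1)) = 0) →
      ∀ N, dt * ∑ n ∈ Finset.range N, s (n + 1) ^ 2 ≤ C * l ^ (-(1 / rho b)) * s 0 ^ 2 := by
  obtain ⟨c, hc, hsym⟩ := hb.exists_symbol_ge hl₀
  refine ⟨3 / (2 * c), by positivity, fun dt hdt l hl s hs N => ?_⟩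
  have hl0 : 0 < l := hl₀.trans_le hl
  have hpi := Real.pi_pos
  set L := l ^ (1 / rho b) with hL
  have hL0 : 0 < L := by positivity
  have hD : 0 < dt * L := by positivity
  obtain ⟨hDi, hDv⟩ := integrable_and_integral_inv_sq_add hD
  have hinside : ∀ r : ℝ, 1 / 2 ≤ r → r < 1 →
      ∑ n ∈ Finset.range N, s (n + 1) ^ 2 * r ^ (2 * n) ≤ 3 / (2 * c) * s 0 ^ 2 / (dt * L) := by
    intro r hr hr1
    have hr0 : 0 ≤ r := by linarith
    have hgen := fun θ => hb.generating_function_mul_symbol hdt hl0.le hs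
      (z := circlePoint r θ) (by rwa [norm_circlePoint hr0])
    have hsm := (hgen 0).1
    rw [norm_circlePoint hr0] at hsm
    have hbes := sum_norm_sq_le_integral hr0 hsm N
    have hpt : ∀ θ ∈ Icc (-Real.pi) Real.pi,
        ‖∑' n, (s (n + 1) : ℂ) * circlePoint r θ ^ n‖ ^ 2 ≤
          s 0 ^ 2 / c * ((dt * L) ^ 2 + θ ^ 2 / 9)⁻¹ := by
      intro θ hθ
      have hz : ‖circlePoint r θ‖ < 1 := by rwa [norm_circlePoint hr0]
      have h1 := hsym l hl _ (one_sub_div_re_pos hdt hz)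
      have h2 := congrArg (fun x : ℂ => ‖x‖ ^ 2) (hgen θ).2
      simp only [norm_mul, mul_pow, Complex.norm_real, Real.norm_eq_abs, sq_abs] at h2
      have h3 := norm_one_sub_circlePoint_sq_ge hr (abs_le.2 hθ)
      have h4 : ‖(1 - circlePoint r θ) / (dt : ℂ)‖ ^ 2 = ‖1 - circlePoint r θ‖ ^ 2 / dt ^ 2 := by
        rw [norm_div, div_pow, Complex.norm_real, Real.norm_eq_abs, sq_abs]
      rw [h4] at h1
      have h5 : c * ((dt * L) ^ 2 + θ ^ 2 / 9) ≤
          dt ^ 2 * ‖(1 - circlePoint r θ) / (dt : ℂ) +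
            l * laplace b ((1 - circlePoint r θ) / (dt : ℂ))‖ ^ 2 := by
        calc c * ((dt * L) ^ 2 + θ ^ 2 / 9)
            ≤ c * ((dt * L) ^ 2 + ‖1 - circlePoint r θ‖ ^ 2) := by gcongr
          _ = dt ^ 2 * (c * (L ^ 2 + ‖1 - circlePoint r θ‖ ^ 2 / dt ^ 2)) := by
              field_simp
          _ ≤ _ := by gcongr
      have h6 : 0 < (dt * L) ^ 2 + θ ^ 2 / 9 := by positivity
      rw [← div_eq_mul_inv, div_div, le_div_iff₀ (by positivity), ← h2]
      gcongr
    have hint : ∫ θ in -Real.pi..Real.pi, ‖∑' n, (s (n + 1) : ℂ) * circlePoint r θ ^ n‖ ^ 2 ≤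
        s 0 ^ 2 / c * (3 * Real.pi / (dt * L)) := by
      have hi := hDi.const_mul (s 0 ^ 2 / c)
      calc ∫ θ in -Real.pi..Real.pi, ‖∑' n, (s (n + 1) : ℂ) * circlePoint r θ ^ n‖ ^ 2
          ≤ ∫ θ in -Real.pi..Real.pi, s 0 ^ 2 / c * ((dt * L) ^ 2 + θ ^ 2 / 9)⁻¹ := by
            refine intervalIntegral.integral_mono_on (by linarith) ?_ hi.intervalIntegrable hpt
            exact ((continuous_tsum_circlePoint hr0 hsm).norm.pow 2).intervalIntegrable _ _
        _ ≤ ∫ θ : ℝ, s 0 ^ 2 / c * ((dt * L) ^ 2 + θ ^ 2 / 9)⁻¹ := by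
            rw [intervalIntegral.integral_of_le (by linarith)]
            exact setIntegral_le_integral hi (ae_of_all _ fun θ => by positivity)
        _ = _ := by rw [integral_const_mul, hDv]
    have h7 := hbes.trans hint
    simp only [Complex.norm_real, Real.norm_eq_abs, sq_abs] at h7
    refine le_of_mul_le_mul_left (h7.trans (le_of_eq ?_)) (show 0 < 2 * Real.pi by positivity)
    field_simp
  have hlim : Tendsto (fun r : ℝ => ∑ n ∈ Finset.range N, s (n + 1) ^ 2 * r ^ (2 * n))
      (𝓝[<] 1) (𝓝 (∑ n ∈ Finset.range N, s (n + 1) ^ 2)) := by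
    have hcont : Continuous fun r : ℝ => ∑ n ∈ Finset.range N, s (n + 1) ^ 2 * r ^ (2 * n) := by
      fun_prop
    have := (hcont.tendsto 1).mono_left (nhdsWithin_le_nhds (s := Iio 1))
    simpa using this
  have hle : ∑ n ∈ Finset.range N, s (n + 1) ^ 2 ≤ 3 / (2 * c) * s 0 ^ 2 / (dt * L) := by
    refine le_of_tendsto hlim ?_
    filter_upwards [Ioo_mem_nhdsLT (show (1 / 2 : ℝ) < 1 by norm_num)] with r hr
    exact hinside r hr.1.le hr.2
  rw [Real.rpow_neg hl0.le, ← hL]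
  calc dt * ∑ n ∈ Finset.range N, s (n + 1) ^ 2
      ≤ dt * (3 / (2 * c) * s 0 ^ 2 / (dt * L)) := by gcongr
    _ = _ := by field_simp

variable {H : Type*} [NormedAddCommGroup H] [InnerProductSpace ℝ H]
variable {A : H →ₗ.[ℝ] H} {K : H →L[ℝ] H}

/-! ### Solution operators of the scheme -/

/-- The operators `x ↦ A v_{n+1}`, where `v` is the solution started at `x`, built from `K = A⁻¹`
and `G = (K + Δt ω₀)⁻¹`: with `w_n = A v_{n+1}` the scheme reads
`(K + Δt ω₀) w_n = v_n - Δt ∑_{k<n} ω_{n-k} w_k`. -/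
noncomputable def fluxOp (K G : H →L[ℝ] H) (ω : ℕ → ℝ) (dt : ℝ) : ℕ → (H →L[ℝ] H)
  | 0 => G
  | n + 1 => G * (K * fluxOp K G ω dt n -
      dt • ∑ k : Fin (n + 1), ω (n + 1 - k) • fluxOp K G ω dt k)
  decreasing_by
  · exact Nat.lt_succ_self n
  · exact k.2

/-- The solution operators `B_n`, with `B_{n+1} = A⁻¹ (A B_{n+1})`. -/
noncomputable def solutionOp (K G : H →L[ℝ] H) (ω : ℕ → ℝ) (dt : ℝ) : ℕ → (H →L[ℝ] H)
  | 0 => 1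
  | n + 1 => K * fluxOp K G ω dt n

theorem fluxOp_apply (K G : H →L[ℝ] H) (ω : ℕ → ℝ) (dt : ℝ) (n : ℕ) (x : H) :
    fluxOp K G ω dt n x = G (solutionOp K G ω dt n x -
      dt • ∑ k ∈ Finset.range n, ω (n - k) • fluxOp K G ω dt k x) := by
  cases n with
  | zero => simp [fluxOp, solutionOp]
  | succ n =>
    rw [fluxOp, solutionOp, ← Fin.sum_univ_eq_sum_range
      (fun k => ω (n + 1 - k) • fluxOp K G ω dt k x)]
    simp

/-- `K` is the compact inverse of the operator `A`, and is symmetric and nonnegative. -/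
structure IsCompactInverse (A : H →ₗ.[ℝ] H) (K : H →L[ℝ] H) : Prop where
  compact : IsCompactOperator K
  mem_domain : ∀ y, K y ∈ A.domain
  apply_inverse : ∀ y, A ⟨K y, mem_domain y⟩ = y
  inverse_apply : ∀ u : A.domain, K (A u) = (u : H)
  inner_symm : ∀ y z, inner ℝ (K y) z = inner ℝ y (K z)
  inner_nonneg : ∀ y, 0 ≤ inner ℝ (K y) y

theorem IsCompactInverse.isSolutionOperators {G : H →L[ℝ] H}
    (hK : IsCompactInverse A K) {dt : ℝ}
    (hG1 : ∀ x, G (K x + (dt * weight b dt 0) • x) = x)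
    (hG2 : ∀ x, K (G x) + (dt * weight b dt 0) • G x = x) :
    IsSolutionOperators b A dt (solutionOp K G (weight b dt) dt) := by
  intro x v
  constructor
  · rintro ⟨hv0, hdom, heq⟩
    have hKA : ∀ n, v (n + 1) = K (A ⟨v (n + 1), hdom n⟩) := fun n =>
      (hK.inverse_apply ⟨v (n + 1), hdom n⟩).symm
    have hflux : ∀ n, A ⟨v (n + 1), hdom n⟩ = fluxOp K G (weight b dt) dt n x := by
      intro n
      induction n using Nat.strong_induction_on with
      | _ n ih =>
        have hvn : v n = solutionOp K G (weight b dt) dt n x := by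
          cases n with
          | zero => simpa [solutionOp] using hv0
          | succ m => rw [hKA m, ih m (Nat.lt_succ_self m)]; rfl
        have h := heq n
        rw [Finset.sum_range_succ, Nat.sub_self, smul_add, smul_smul] at h
        have hs : ∑ k ∈ Finset.range n, weight b dt (n - k) • A ⟨v (k + 1), hdom k⟩ =
            ∑ k ∈ Finset.range n, weight b dt (n - k) • fluxOp K G (weight b dt) dt k x :=
          Finset.sum_congr rfl fun k hk => by rw [ih k (Finset.mem_range.1 hk)]
        rw [hs, hvn] at h
        rw [fluxOp_apply, ← hG1 (A ⟨v (n + 1), hdom n⟩), ← hKA n]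
        congr 1
        rw [← sub_eq_zero]
        rw [← h]
        abel
    intro k
    cases k with
    | zero => simpa [solutionOp] using hv0
    | succ n => rw [hKA n, hflux n]; rfl
  · intro hv
    have hv1 : ∀ n, v (n + 1) = K (fluxOp K G (weight b dt) dt n x) := fun n => hv (n + 1)
    have hdom : ∀ n, v (n + 1) ∈ A.domain := fun n => by rw [hv1]; exact hK.mem_domain _
    have hA' : ∀ n, A ⟨v (n + 1), hdom n⟩ = fluxOp K G (weight b dt) dt n x := by
      intro n
      have h := hK.apply_inverse (fluxOp K G (weight b dt) dt n x)
      rw [← h]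
      congr 1
      exact Subtype.ext (hv1 n)
    refine ⟨by simpa [solutionOp] using hv 0, hdom, fun n => ?_⟩
    simp_rw [hA']
    rw [Finset.sum_range_succ, Nat.sub_self, smul_add, smul_smul, hv1 n, hv n]
    have h := hG2 (solutionOp K G (weight b dt) dt n x - dt • ∑ k ∈ Finset.range n,
      weight b dt (n - k) • fluxOp K G (weight b dt) dt k x)
    rw [← fluxOp_apply, eq_sub_iff_add_eq] at h
    rw [← h]
    abel

/-! ### Spectral decomposition -/

/-- The eigenspaces of `A` are those of `K = A⁻¹`. At `μ = 0` both sides describe `{0}`: there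
`μ⁻¹ = 0`, and `K` is injective. -/
theorem IsCompactInverse.mem_eigenspace_iff
    (hK : IsCompactInverse A K) {μ : ℝ} {u : H} : u ∈ eigenspace A μ ↔ K u = μ⁻¹ • u := by
  have hinj : K u = 0 → u = 0 := by
    intro h
    rw [← hK.apply_inverse u]
    have : (⟨K u, hK.mem_domain u⟩ : A.domain) = 0 := Subtype.ext h
    rw [this, LinearPMap.map_zero]
  have hmem : u ∈ eigenspace A μ ↔ ∃ h : u ∈ A.domain, A ⟨u, h⟩ = μ • u := by
    simp only [eigenspace, Submodule.mem_map, LinearMap.mem_ker, LinearMap.sub_apply,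
      LinearMap.smul_apply, Submodule.subtype_apply, sub_eq_zero]
    constructor
    · rintro ⟨y, hy, rfl⟩
      exact ⟨y.2, hy⟩
    · rintro ⟨h, hu⟩
      exact ⟨⟨u, h⟩, hu, rfl⟩
  rw [hmem]
  constructor
  · rintro ⟨h, hu⟩
    have h1 := hK.inverse_apply ⟨u, h⟩
    rw [hu, map_smul] at h1
    simp only at h1
    rcases eq_or_ne μ 0 with rfl | hμ
    · have h0 : u = 0 := by rw [← h1, zero_smul]
      simp [h0]
    · rwa [eq_inv_smul_iff₀ hμ]
  · intro hu
    rcases eq_or_ne μ 0 with rfl | hμ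
    · have h0 : u = 0 := hinj (by simpa using hu)
      subst h0
      exact ⟨A.domain.zero_mem, by
        rw [smul_zero]; exact LinearPMap.map_zero A⟩
    · have h1 : u = K (μ • u) := by rw [map_smul, hu, smul_smul, mul_inv_cancel₀ hμ, one_smul]
      have h2 : u ∈ A.domain := by rw [h1]; exact hK.mem_domain _
      have h3 : (⟨u, h2⟩ : A.domain) = ⟨K (μ • u), hK.mem_domain _⟩ := Subtype.ext h1
      exact ⟨h2, by rw [h3, hK.apply_inverse]⟩

theorem IsCompactInverse.topologicalClosure_eigenspace
    (hK : IsCompactInverse A K) (μ : ℝ) :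
    (eigenspace A μ).topologicalClosure = Module.End.eigenspace (K : H →ₗ[ℝ] H) μ⁻¹ := by
  have h : eigenspace A μ = Module.End.eigenspace (K : H →ₗ[ℝ] H) μ⁻¹ := by
    ext u
    rw [hK.mem_eigenspace_iff, Module.End.mem_eigenspace_iff]
    rfl
  rw [h]
  refine IsClosed.submodule_topologicalClosure_eq ?_
  have h2 : (Module.End.eigenspace (K : H →ₗ[ℝ] H) μ⁻¹ : Set H) = {u | K u = μ⁻¹ • u} := by
    ext u
    exact Module.End.mem_eigenspace_iff
  rw [h2]
  exact isClosed_eq K.continuous (by fun_prop)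

theorem IsCompactInverse.orthogonalFamily
    (hK : IsCompactInverse A K) :
    OrthogonalFamily ℝ (fun μ => (eigenspace A μ).topologicalClosure)
      fun μ => (eigenspace A μ).topologicalClosure.subtypeₗᵢ := by
  have hsym : (K : H →ₗ[ℝ] H).IsSymmetric := hK.inner_symm
  have h := hsym.orthogonalFamily_eigenspaces.comp (inv_injective (G := ℝ))
  intro μ ν hne u w
  exact h hne ⟨u, by rw [← hK.topologicalClosure_eigenspace]; exact u.2⟩
    ⟨w, by rw [← hK.topologicalClosure_eigenspace]; exact w.2⟩

/-- Eigenvalues of `A` are bounded below by a positive number, since those of `K = A⁻¹` are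
positive and at most `‖K‖`. -/
theorem IsCompactInverse.eigenvalue_ge
    (hK : IsCompactInverse A K) {μ : ℝ} {e : H}
    (he : e ∈ (eigenspace A μ).topologicalClosure) (hne : e ≠ 0) : (‖K‖ + 1)⁻¹ ≤ μ := by
  rw [hK.topologicalClosure_eigenspace, Module.End.mem_eigenspace_iff] at he
  have he' : K e = μ⁻¹ • e := he
  have hn : 0 < ‖e‖ := norm_pos_iff.2 hne
  have h0 : 0 ≤ μ⁻¹ := by
    have h := hK.inner_nonneg e
    rw [he', real_inner_smul_left, real_inner_self_eq_norm_sq] at h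
    exact nonneg_of_mul_nonneg_left h (by positivity)
  have hμ : μ ≠ 0 := by
    rintro rfl
    rw [inv_zero, zero_smul] at he'
    apply hne
    rw [← hK.apply_inverse e]
    have : (⟨K e, hK.mem_domain e⟩ : A.domain) = 0 := Subtype.ext he'
    rw [this, LinearPMap.map_zero]
  have hpos : 0 < μ := lt_of_le_of_ne (inv_nonneg.1 h0) hμ.symm
  have h1 := K.le_opNorm e
  rw [he', norm_smul, Real.norm_eq_abs, abs_of_nonneg h0] at h1
  have h2 : μ⁻¹ ≤ ‖K‖ := le_of_mul_le_mul_right h1 hn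
  rw [inv_le_comm₀ (by positivity) hpos]
  linarith

/-- The coefficient of a solution along an eigenvector solves the scalar scheme. -/
theorem IsCompactInverse.inner_scheme (hK : IsCompactInverse A K) {dt : ℝ} {x : H} {v : ℕ → H}
    (hv : IsDiscreteSolution b A dt x v) {μ : ℝ} (hμ : μ ≠ 0) {e : H}
    (he : e ∈ (eigenspace A μ).topologicalClosure) (n : ℕ) :
    inner ℝ (v (n + 1)) e - inner ℝ (v n) e +
      dt * ∑ k ∈ Finset.range (n + 1), weight b dt (n - k) * (μ * inner ℝ (v (k + 1)) e) = 0 := by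
  obtain ⟨-, hdom, heq⟩ := hv
  rw [hK.topologicalClosure_eigenspace, Module.End.mem_eigenspace_iff] at he
  have he' : K e = μ⁻¹ • e := he
  have hA' : ∀ k, μ * inner ℝ (v (k + 1)) e = inner ℝ (A ⟨v (k + 1), hdom k⟩) e := by
    intro k
    have h : inner ℝ (v (k + 1)) e = inner ℝ (K (A ⟨v (k + 1), hdom k⟩)) e :=
      congrArg (fun y => inner ℝ y e) (hK.inverse_apply ⟨v (k + 1), hdom k⟩).symm
    rw [h, hK.inner_symm, he', real_inner_smul_right, mul_inv_cancel_left₀ hμ]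
  have h := congrArg (fun y => inner ℝ y e) (heq n)
  simp only [inner_add_left, inner_sub_left, real_inner_smul_left, sum_inner, inner_zero_left] at h
  simp_rw [hA']
  exact h

theorem IsCompactInverse.abs_inner_le (hK : IsCompactInverse A K) (hb : KernelAssumption b)
    {dt : ℝ} (hdt : 0 < dt) {x : H} {v : ℕ → H} (hv : IsDiscreteSolution b A dt x v) {μ : ℝ} {e : H}
    (he : e ∈ (eigenspace A μ).topologicalClosure) (n : ℕ) :
    |inner ℝ (v n) e| ≤ |inner ℝ x e| := by
  rcases eq_or_ne e 0 with rfl | hne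
  · simp
  have hμ : 0 < μ := lt_of_lt_of_le (by positivity) (hK.eigenvalue_ge he hne)
  have h := hb.scalar_abs_le hdt hμ.le (s := fun n => inner ℝ (v n) e)
    (fun n => hK.inner_scheme hv hμ.ne' he n) n
  simpa [hv.1] using h

variable [CompleteSpace H]

theorem OperatorAssumption.exists_isCompactInverse (hA : OperatorAssumption A) :
    ∃ K : H →L[ℝ] H, IsCompactInverse A K := by
  obtain ⟨K, hc, hr, hl⟩ := hA.compact_inverse
  choose hmem happ using hr
  have hsym : A.IsFormalAdjoint A := by
    have h := LinearPMap.adjoint_isFormalAdjoint hA.isSelfAdjoint.dense_domain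
    rwa [LinearPMap.isSelfAdjoint_def.1 hA.isSelfAdjoint] at h
  refine ⟨K, hc, hmem, happ, hl, fun y z => ?_, fun y => ?_⟩
  · have h := hsym ⟨K y, hmem y⟩ ⟨K z, hmem z⟩
    rw [happ, happ] at h
    exact h.symm
  · have h := hA.nonneg ⟨K y, hmem y⟩
    rw [happ] at h
    rwa [real_inner_comm]

theorem IsCompactInverse.isUnit_add (hK : IsCompactInverse A K)
    {c : ℝ} (hc : 0 < c) : IsUnit (K + c • (1 : H →L[ℝ] H)) := by
  refine ContinuousLinearMap.isUnit_of_forall_le_norm_inner_map _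
    (c := c.toNNReal) (Real.toNNReal_pos.2 hc) fun x => ?_
  have h : inner ℝ ((K + c • (1 : H →L[ℝ] H)) x) x = inner ℝ (K x) x + c * ‖x‖ ^ 2 := by
    simp [inner_add_left, real_inner_smul_left]
  rw [h, Real.norm_eq_abs, Real.coe_toNNReal c hc.le]
  refine le_trans ?_ (le_abs_self _)
  have := hK.inner_nonneg x
  linarith

/-- The spectral projection `P_μ` of `A`, the orthogonal projection onto the eigenspace of `μ`. It
is zero when `μ` is not an eigenvalue, so that sums over all real `μ` are sums over the spectrum. -/
noncomputable def specProj (A : H →ₗ.[ℝ] H) (μ : ℝ) : H →L[ℝ] H :=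
  (eigenspace A μ).topologicalClosure.starProjection

theorem IsCompactInverse.isHilbertSum
    (hK : IsCompactInverse A K) :
    IsHilbertSum ℝ (fun μ => (eigenspace A μ).topologicalClosure)
      fun μ => (eigenspace A μ).topologicalClosure.subtypeₗᵢ := by
  refine IsHilbertSum.mkInternal _ hK.orthogonalFamily ?_
  have hsym : (K : H →ₗ[ℝ] H).IsSymmetric := hK.inner_symm
  have h := ContinuousLinearMap.orthogonalComplement_iSup_eigenspaces_eq_bot hK.compact hsym
  simp_rw [hK.topologicalClosure_eigenspace]
  have h2 : (⨆ μ : ℝ, Module.End.eigenspace (K : H →ₗ[ℝ] H) μ⁻¹) =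
      ⨆ ν : ℝ, Module.End.eigenspace (K : H →ₗ[ℝ] H) ν :=
    (inv_involutive (G := ℝ)).surjective.iSup_comp _
  rw [h2, Submodule.topologicalClosure_eq_top_iff.2 h]

theorem specProj_mem (A : H →ₗ.[ℝ] H) (μ : ℝ) (x : H) :
    specProj A μ x ∈ (eigenspace A μ).topologicalClosure :=
  Submodule.starProjection_apply_mem _ x

theorem inner_specProj_left (A : H →ₗ.[ℝ] H) (μ : ℝ) (x : H) {e : H}
    (he : e ∈ (eigenspace A μ).topologicalClosure) :
    inner ℝ (specProj A μ x) e = inner ℝ x e := by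
  rw [specProj, Submodule.inner_starProjection_left_eq_right,
    Submodule.starProjection_eq_self_iff.2 he]

theorem IsCompactInverse.specProj_of_hasSum
    (hK : IsCompactInverse A K) {u : ℝ → H}
    (hu : ∀ μ, u μ ∈ (eigenspace A μ).topologicalClosure) {x : H} (hx : HasSum u x) (ν : ℝ) :
    specProj A ν x = u ν := by
  have h := hx.mapL (specProj A ν)
  have h0 : ∀ μ, μ ≠ ν → specProj A ν (u μ) = 0 := by
    intro μ hne
    rw [specProj, Submodule.starProjection_apply_eq_zero_iff, Submodule.mem_orthogonal]
    intro w hw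
    exact hK.orthogonalFamily hne.symm ⟨w, hw⟩ ⟨u μ, hu μ⟩
  rw [h.unique (hasSum_single ν h0)]
  exact Submodule.starProjection_eq_self_iff.2 (hu ν)

theorem IsCompactInverse.hasSum_specProj
    (hK : IsCompactInverse A K) (x : H) : HasSum (fun μ => specProj A μ x) x := by
  have h := hK.isHilbertSum.hasSum_linearIsometryEquiv_symm (hK.isHilbertSum.linearIsometryEquiv x)
  rw [LinearIsometryEquiv.symm_apply_apply] at h
  have h2 := fun ν => hK.specProj_of_hasSum (fun μ => Subtype.coe_prop _) h ν
  refine h.congr_fun fun μ => ?_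
  rw [h2]
  rfl

/-- Parseval's identity. -/
theorem IsCompactInverse.hasSum_norm_sq
    (hK : IsCompactInverse A K) (x : H) :
    HasSum (fun μ => ‖specProj A μ x‖ ^ 2) (‖x‖ ^ 2) := by
  have h := (hK.hasSum_specProj x).mapL (innerSL ℝ x)
  rw [innerSL_apply_apply, real_inner_self_eq_norm_sq] at h
  refine h.congr_fun fun μ => ?_
  rw [innerSL_apply_apply, ← inner_specProj_left A μ x (specProj_mem A μ x),
    real_inner_self_eq_norm_sq]

theorem IsCompactInverse.hasSum_fracPow_norm_sq
    (hK : IsCompactInverse A K) {s : ℝ} (hs : s ≤ 0) (x : H) :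
    HasSum (fun μ : ℝ => (μ ^ s) ^ 2 * ‖specProj A μ x‖ ^ 2) (‖fracPow A s x‖ ^ 2) := by
  have hK0 : 0 < (‖K‖ + 1)⁻¹ := by positivity
  have hbd : ∀ μ : ℝ, (μ ^ s) ^ 2 * ‖specProj A μ x‖ ^ 2 ≤
      (((‖K‖ + 1)⁻¹) ^ s) ^ 2 * ‖specProj A μ x‖ ^ 2 := by
    intro μ
    rcases eq_or_ne (specProj A μ x) 0 with h0 | h0
    · simp [h0]
    · have h1 := hK.eigenvalue_ge (specProj_mem A μ x) h0
      have h2 : μ ^ s ≤ ((‖K‖ + 1)⁻¹) ^ s := Real.rpow_le_rpow_of_nonpos hK0 h1 hs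
      have h3 : 0 ≤ μ ^ s := Real.rpow_nonneg (hK0.le.trans h1) s
      gcongr
  have hsq : Summable fun μ : ℝ => (μ ^ s) ^ 2 * ‖specProj A μ x‖ ^ 2 :=
    Summable.of_nonneg_of_le (fun μ => by positivity) hbd ((hK.hasSum_norm_sq x).summable.mul_left _)
  have hmem : ∀ μ : ℝ, (μ ^ s) • specProj A μ x ∈ (eigenspace A μ).topologicalClosure :=
    fun μ => Submodule.smul_mem _ _ (specProj_mem A μ x)
  have hsum : Summable fun μ : ℝ => (μ ^ s) • specProj A μ x := by
    refine (hK.orthogonalFamily.summable_iff_norm_sq_summable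
      (fun μ => ⟨(μ ^ s) • specProj A μ x, hmem μ⟩)).2 ?_
    refine hsq.congr fun μ => ?_
    rw [Submodule.coe_norm, norm_smul, mul_pow, Real.norm_eq_abs, sq_abs]
  have h := hK.hasSum_norm_sq (fracPow A s x)
  refine h.congr_fun fun μ => ?_
  have h3 : specProj A μ (fracPow A s x) = (μ ^ s) • specProj A μ x :=
    hK.specProj_of_hasSum hmem hsum.hasSum μ
  rw [h3, norm_smul, mul_pow, Real.norm_eq_abs, sq_abs]

/-! ### Estimates on the spectral components -/

theorem IsCompactInverse.norm_specProj_sq_le (hK : IsCompactInverse A K) (hb : KernelAssumption b)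
    {dt : ℝ} (hdt : 0 < dt) {x : H} {v : ℕ → H} (hv : IsDiscreteSolution b A dt x v) (μ : ℝ)
    (n : ℕ) : ‖specProj A μ (v n)‖ ^ 2 ≤ ‖specProj A μ x‖ ^ 2 := by
  have hq := specProj_mem A μ (v n)
  have h := hK.abs_inner_le hb hdt hv hq n
  rw [← inner_specProj_left A μ (v n) hq, ← inner_specProj_left A μ x hq,
    real_inner_self_eq_norm_sq, abs_of_nonneg (by positivity)] at h
  have h2 := abs_real_inner_le_norm (specProj A μ x) (specProj A μ (v n))
  nlinarith [sq_nonneg (‖specProj A μ x‖ - ‖specProj A μ (v n)‖),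
    norm_nonneg (specProj A μ x), norm_nonneg (specProj A μ (v n))]

/-- `P_μ v_n` is a multiple of `P_μ x`: the component of the solution along an eigenvector
orthogonal to `P_μ x` starts from zero and stays zero. -/
theorem IsCompactInverse.norm_specProj_sq_mul (hK : IsCompactInverse A K)
    (hb : KernelAssumption b) {dt : ℝ} (hdt : 0 < dt) {x : H} {v : ℕ → H}
    (hv : IsDiscreteSolution b A dt x v) (μ : ℝ) (n : ℕ) :
    ‖specProj A μ (v n)‖ ^ 2 * ‖specProj A μ x‖ ^ 2 = inner ℝ (v n) (specProj A μ x) ^ 2 := by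
  set p := specProj A μ x with hp
  set q := specProj A μ (v n) with hq
  have hpm : p ∈ (eigenspace A μ).topologicalClosure := specProj_mem A μ x
  have hqm : q ∈ (eigenspace A μ).topologicalClosure := specProj_mem A μ (v n)
  -- `e` is orthogonal to `p`, hence to `x`
  have he : ‖p‖ ^ 2 • q - inner ℝ q p • p ∈ (eigenspace A μ).topologicalClosure :=
    Submodule.sub_mem _ (Submodule.smul_mem _ _ hqm) (Submodule.smul_mem _ _ hpm)
  have h := hK.abs_inner_le hb hdt hv he n
  rw [← inner_specProj_left A μ (v n) he, ← inner_specProj_left A μ x he, ← hp, ← hq] at h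
  simp only [inner_sub_right, real_inner_smul_right, real_inner_self_eq_norm_sq] at h
  rw [real_inner_comm q p] at h
  have h0 : ‖p‖ ^ 2 * inner ℝ q p - inner ℝ q p * ‖p‖ ^ 2 = 0 := by ring
  rw [h0, abs_zero] at h
  have h1 := abs_eq_zero.1 (le_antisymm h (abs_nonneg _))
  rw [← inner_specProj_left A μ (v n) hpm, ← hq]
  linarith

theorem sum_Icc_one_eq_sum_range (f : ℕ → ℝ) (n : ℕ) :
    ∑ k ∈ Finset.Icc 1 n, f k = ∑ k ∈ Finset.range n, f (k + 1) := by
  induction n with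
  | zero => simp
  | succ n ih => rw [Finset.sum_Icc_succ_top (by omega), Finset.sum_range_succ, ih]

theorem IsCompactInverse.exists_stability (hK : IsCompactInverse A K) (hb : KernelAssumption b) :
    ∃ C : ℝ, 0 < C ∧ ∀ dt : ℝ, 0 < dt → ∀ (x : H) (v : ℕ → H), IsDiscreteSolution b A dt x v →
      (∀ k, ‖v k‖ ≤ ‖x‖) ∧ ∀ n, dt * ∑ k ∈ Finset.range n, ‖v (k + 1)‖ ^ 2 ≤
        C * fracNorm A (-(1 / rho b)) x ^ 2 := by
  have hK0 : 0 < (‖K‖ + 1)⁻¹ := by positivity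
  obtain ⟨C, hC, hbound⟩ := hb.exists_scalar_sum_sq_le hK0
  refine ⟨C, hC, fun dt hdt x v hv => ⟨fun k => ?_, fun n => ?_⟩⟩
  · exact le_of_sq_le_sq (hasSum_le (fun μ => hK.norm_specProj_sq_le hb hdt hv μ k)
      (hK.hasSum_norm_sq (v k)) (hK.hasSum_norm_sq x)) (norm_nonneg _)
  · have hρ : 0 < rho b := by linarith [hb.one_lt_rho]
    have hL := (hasSum_sum fun k (_ : k ∈ Finset.range n) =>
      hK.hasSum_norm_sq (v (k + 1))).mul_left dt
    have hR := (hK.hasSum_fracPow_norm_sq (s := -(1 / rho b) / 2)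
      (by have : 0 < 1 / rho b := by positivity
          linarith) x).mul_left C
    refine hasSum_le (fun μ => ?_) hL hR
    rcases eq_or_ne (specProj A μ x) 0 with h0 | h0
    · have hz : ∀ k, ‖specProj A μ (v k)‖ ^ 2 = 0 := fun k => by
        have h := hK.norm_specProj_sq_le hb hdt hv μ k
        rw [h0, norm_zero] at h
        exact le_antisymm (by simpa using h) (by positivity)
      simp [hz, h0]
    · have hμ := hK.eigenvalue_ge (specProj_mem A μ x) h0
      have hμ0 : 0 < μ := hK0.trans_le hμ
      have h := hbound dt hdt μ hμ (fun k => inner ℝ (v k) (specProj A μ x))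
        (fun k => hK.inner_scheme hv hμ0.ne' (specProj_mem A μ x) k) n
      simp only [← hK.norm_specProj_sq_mul hb hdt hv μ, ← Finset.sum_mul] at h
      rw [hv.1] at h
      have hp : 0 < ‖specProj A μ x‖ ^ 2 := by positivity
      have hpow : (μ ^ (-(1 / rho b) / 2)) ^ 2 = μ ^ (-(1 / rho b)) := by
        rw [← Real.rpow_natCast, ← Real.rpow_mul hμ0.le]
        norm_num
      rw [hpow]
      refine le_of_mul_le_mul_right ?_ hp
      linarith

end VolterraEuler

theorem corollary4p2 {H : Type*} [NormedAddCommGroup H] [InnerProductSpace ℝ H] [CompleteSpace H]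
    [TopologicalSpace.SeparableSpace H]
    (A : H →ₗ.[ℝ] H) (hA : VolterraEuler.OperatorAssumption A)
    (b : ℝ → ℝ) (hb : VolterraEuler.KernelAssumption b) :
    ∃ C : ℝ, 0 < C ∧ ∀ dt : ℝ, 0 < dt →
      ∃ B : ℕ → H →L[ℝ] H, VolterraEuler.IsSolutionOperators b A dt B ∧
        ∀ x : H,
          (∀ k : ℕ, 1 ≤ k → ‖B k x‖ ≤ ‖x‖) ∧
          ∀ n : ℕ, 1 ≤ n →
            dt * ∑ k ∈ Finset.Icc 1 n, ‖B k x‖ ^ 2 ≤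
              C * VolterraEuler.fracNorm A (-(1 / VolterraEuler.rho b)) x ^ 2 := by
  obtain ⟨K, hK⟩ := hA.exists_isCompactInverse
  obtain ⟨C, hC, hstab⟩ := hK.exists_stability hb
  refine ⟨C, hC, fun dt hdt => ?_⟩
  obtain ⟨U, hU⟩ := hK.isUnit_add (mul_pos hdt (hb.weight_zero_pos hdt))
  have hB := hK.isSolutionOperators (b := b) (dt := dt) (G := (U⁻¹ : (H →L[ℝ] H)ˣ))
    (fun x => by
      have h := congrArg (fun T : H →L[ℝ] H => T x) U.inv_mul
      rw [hU] at h
      simpa using h)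
    (fun x => by
      have h := congrArg (fun T : H →L[ℝ] H => T x) U.mul_inv
      rw [hU] at h
      simpa using h)
  refine ⟨_, hB, fun x => ?_⟩
  obtain ⟨h1, h2⟩ := hstab dt hdt x _ ((hB x _).2 fun _ => rfl)
  refine ⟨fun k _ => h1 k, fun n _ => ?_⟩
  rw [VolterraEuler.sum_Icc_one_eq_sum_range]
  exact h2 n
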